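/- Let $E$ be a real affine space of finite dimension $n \ge 0$, with associated vector space $\vec E$. A family $\mathcal P$ of subsets of $E$ is a *Yao-Yao partition* of $E$ with *center* $x \in E$ in the following recursive sense. If $n = 0$ and $E = \{x\}$, then $\mathcal P = \{\{x\}\}$ is a Yao-Yao partition of $E$ with center $x$. If $n \ge 1$, then $\mathcal P$ is a Yao-Yao partition of $E$ with center $x$ if there are an affine hyperplane $F$ of $E$, a vector $v \in \vec E \setminus \vec F$ and two Yao-Yao partitions $\mathcal P_1$, $\mathcal P_{-1}$ of $F$, both with center $x$, such that $$\mathcal P = \{A + \mathbb R_- v : A \in \mathcal P_{-1}\} \cup \{A + \mathbb R_+ v : A \in \mathcal P_1\}.$$ Let $\mu$ be a finite non-negative Borel measure on $E$ with $\mu(F) = 0$ for every affine hyperplane $F$ of $E$. A *Yao-Yao equipartition* for $\mu$ is a Yao-Yao partition $\mathcal P$ of $E$ such that $\mu(A) = 2^{-n}\mu(E)$ for every $A \in \mathcal P$. A point $x$ is a *Yao-Yao center* of $\mu$ if it is the center of some Yao-Yao equipartition for $\mu$. A point $x$ is a *center of symmetry* of $\mu$ if the image of $\mu$ under the reflection $y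 \mapsto x + (x - y)$ is $\mu$. **Theorem.** There exists a Yao-Yao equipartition $\mathcal P$ for $\mu$, with some center $x$. It has exactly $2^n$ elements, their union is $E$, distinct elements have disjoint interiors, and each element is a cone with apex $x$ of the form $$\Bigl\{x + \sum_{i=1}^n c_i v_i : c_1, \dots, c_n \ge 0\Bigr\}$$ for some basis $v_1, \dots, v_n$ of $\vec E$ (depending on the element). Moreover, if $\mu$ has a center of symmetry $x \in E$, then $x$ is a Yao-Yao center of $\mu$. -/

import Mathlib

open scoped ENNReal

namespace YaoYao

section Affine

variable {V E : Type*} [AddCommGroup V] [Module ℝ V] [AddTorsor V E]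

/-- `F` is an affine hyperplane of the affine subspace `G`. -/
def IsHyperplaneOf (F G : AffineSubspace ℝ E) : Prop :=
  (F : Set E).Nonempty ∧ F ≤ G ∧
    Module.finrank ℝ F.direction + 1 = Module.finrank ℝ G.direction

/-- The set `A + ℝ₊ v`. (The set `A + ℝ₋ v` is `sweep A (-v)`.) -/
def sweep (A : Set E) (v : V) : Set E :=
  {p | ∃ a ∈ A, ∃ t : ℝ, 0 ≤ t ∧ p = t • v +ᵥ a}

/-- `IsPartitionOf G P x`: the family of sets `P` is a Yao-Yao partition, with center `x`, of the
(nonempty, finite-dimensional) affine subspace `G` of `E`. -/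
inductive IsPartitionOf : AffineSubspace ℝ E → Set (Set E) → E → Prop
  | point (G : AffineSubspace ℝ E) (x : E) (hG : (G : Set E) = {x}) :
      IsPartitionOf G {{x}} x
  | step (G F : AffineSubspace ℝ E) (v : V) (Ppos Pneg : Set (Set E)) (x : E)
      (hF : IsHyperplaneOf F G) (hvG : v ∈ G.direction) (hvF : v ∉ F.direction)
      (hpos : IsPartitionOf F Ppos x) (hneg : IsPartitionOf F Pneg x) :
      IsPartitionOf G
        ((fun A => sweep A (-v)) '' Pneg ∪ (fun A => sweep A v) '' Ppos) x

/-- `P` is a Yao-Yao partition, with center `x`, of the whole space `E`. -/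
def IsYaoYaoPartition (P : Set (Set E)) (x : E) : Prop :=
  IsPartitionOf (⊤ : AffineSubspace ℝ E) P x

/-- `A = x + pos(v₁, …, vₙ)` for some basis `v₁, …, vₙ` of the vector space `V`. -/
def IsSimplicialCone (x : E) (A : Set E) : Prop :=
  ∃ b : Module.Basis (Fin (Module.finrank ℝ V)) ℝ V,
    A = {p | ∃ c : Fin (Module.finrank ℝ V) → ℝ, (∀ i, 0 ≤ c i) ∧ p = (∑ i, c i • b i) +ᵥ x}

end Affine

/-- A family of sets covering `E`, distinct members of which have disjoint interiors. -/
def IsPartition {E : Type*} [TopologicalSpace E] (P : Set (Set E)) : Prop :=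
  ⋃₀ P = Set.univ ∧ P.Pairwise fun A B => Disjoint (interior A) (interior B)

section Measure

variable {V E : Type*} [AddCommGroup V] [Module ℝ V] [AddTorsor V E] [MeasurableSpace E]

/-- `P` is a Yao-Yao equipartition for `μ`, with center `x`. -/
def IsYaoYaoEquipartition (μ : MeasureTheory.Measure E) (P : Set (Set E)) (x : E) : Prop :=
  IsYaoYaoPartition (V := V) P x ∧
    ∀ A ∈ P, μ A = ((2 : ℝ≥0∞) ^ Module.finrank ℝ V)⁻¹ * μ Set.univ

/-- `x` is a Yao-Yao center of `μ`. -/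
def IsYaoYaoCenter (μ : MeasureTheory.Measure E) (x : E) : Prop :=
  ∃ P : Set (Set E), IsYaoYaoEquipartition (V := V) μ P x

/-- `x` is a center of symmetry of `μ`: the image of `μ` under the reflection
`y ↦ x + (x - y)` is `μ`. -/
def IsCenterOfSymmetry (μ : MeasureTheory.Measure E) (x : E) : Prop :=
  μ.map (AffineEquiv.pointReflection ℝ (V₁ := V) x) = μ

end Measure

end YaoYao

/-!
The equipartition of a general measure is built from affine coordinates `ξ 0, …, ξ (n - 1)` and a
triangular system of affine functionals, the charts `Φ τ`, indexed by the nodes `τ` (lists of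
signs) of a binary tree. The chart at a node of depth `m` is `ξ m - c m - ∑ a m ρ • Φ ρ`, the sum
being over the nodes `ρ` strictly above `τ`, and the cell of a leaf `σ` is the set where the charts
along the branch have the signs prescribed by `σ`. For every choice of the coefficients these cells
form a Yao-Yao partition (`IsCoordinateSystem.isYaoYaoPartition_cells`), because along a branch the
charts are dual to a basis of signed axes; so the cells are also simplicial cones.

The coefficients are chosen one depth at a time. Once the `2 ^ m` cells of depth `m` have equal
mass, the `2 ^ m` numbers `c m`, `a m ρ` have to be chosen so that the graph of the corresponding
function of the earlier charts bisects each of these cells (`exists_pathSum_bisecting`). This is a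
system with as many equations as unknowns, and it has two features (`signRich_pathFamily`): a
nonzero function of the family has a strict sign on some cell, as one sees by choosing signs
greedily down the tree; and for every nonzero pattern of signs on the cells some function agrees
weakly with the pattern, and strictly somewhere, because either the pattern has constant sign or
some node separates two constant opposite signs. These two facts suffice in general
(`SignRich.exists_bisecting`). The sign function is smoothed to `arctan (k u) + u / k`; the sum of
the squares of the resulting imbalances is coercive by the first fact, and at a minimum it vanishes
by the second. As `k → ∞`, the solutions stay bounded by the first fact again, and a limit point
bisects every cell because the measure vanishes on hyperplanes.

If `x` is a center of symmetry, project the part of the measure in an open half-space bounded by a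
hyperplane through `x` centrally from `x` to a parallel hyperplane, and take a Yao-Yao equipartition
of the image. The cones over its members with apex `x` and their reflections form a Yao-Yao
equipartition centered at `x` (`isYaoYaoCenter_of_isCenterOfSymmetry`).
-/

namespace YaoYao

open MeasureTheory Filter Topology

/-! ### Bisecting finitely many measures simultaneously -/

/-- The sign conditions on a linear family `B i : X → (Ω → ℝ)`, `i : I`, relative to measures
`ν i`, under which suitable members of the family bisect all the `ν i` at the same time.
`exists_pos_or_neg` makes the family coercive; `exists_of_signs` supplies, for every nonzero
pattern of signs, a direction whose signs weakly agree with the pattern. -/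
structure SignRich {Ω I X : Type*} [MeasurableSpace Ω] [AddCommGroup X] [Module ℝ X]
    (ν : I → Measure Ω) (B : I → X →ₗ[ℝ] (Ω → ℝ)) : Prop where
  exists_pos_or_neg : ∀ x, x ≠ 0 →
    ∃ i, (∀ᵐ p ∂ν i, 0 < B i x p) ∨ (∀ᵐ p ∂ν i, B i x p < 0)
  exists_of_signs : ∀ s : I → ℝ, s ≠ 0 →
    ∃ x, (∀ i, ∀ᵐ p ∂ν i, 0 ≤ s i * B i x p) ∧ ∃ i, ∀ᵐ p ∂ν i, 0 < s i * B i x p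

/-- A family of functions bounded linearly in the parameter, together with target functions
bounded by one. -/
structure BoundedFamily {Ω I X : Type*} [MeasurableSpace Ω] [NormedAddCommGroup X]
    [NormedSpace ℝ X] (f : I → Ω → ℝ) (B : I → X →ₗ[ℝ] (Ω → ℝ)) (K : ℝ) : Prop where
  measurable_target : ∀ i, Measurable (f i)
  measurable_family : ∀ i x, Measurable (B i x)
  target_le : ∀ i p, |f i p| ≤ 1
  family_le : ∀ i x p, |B i x p| ≤ K * ‖x‖

theorem integrable_of_measurable_of_abs_le {Ω : Type*} [MeasurableSpace Ω] {ν : Measure Ω}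
    [IsFiniteMeasure ν] {g : Ω → ℝ} (hg : Measurable g) {K : ℝ} (h : ∀ p, |g p| ≤ K) :
    Integrable g ν :=
  Integrable.of_bound hg.aestronglyMeasurable K (Eventually.of_forall h)

theorem integral_pos_of_ae_pos {Ω : Type*} [MeasurableSpace Ω] {ν : Measure Ω}
    (hν : ν ≠ 0) {g : Ω → ℝ} (hg : Integrable g ν) (h : ∀ᵐ p ∂ν, 0 < g p) :
    0 < ∫ p, g p ∂ν := by
  rw [integral_pos_iff_support_of_nonneg_ae (h.mono fun p hp => hp.le) hg]
  have h1 : ν (Function.support g)ᶜ = 0 := by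
    rw [measure_eq_zero_iff_ae_notMem]
    filter_upwards [h] with p hp hp'
    exact hp' (by simpa using hp.ne')
  rw [pos_iff_ne_zero]
  intro h2
  apply hν
  rw [← Measure.measure_univ_eq_zero, ← Set.union_compl_self (Function.support g)]
  exact measure_union_null h2 h1

theorem abs_arctan_le (u : ℝ) : |Real.arctan u| ≤ Real.pi / 2 :=
  abs_le.2 ⟨(Real.neg_pi_div_two_lt_arctan u).le, (Real.arctan_lt_pi_div_two u).le⟩

theorem continuous_family_apply {Ω I X : Type*} [NormedAddCommGroup X]
    [NormedSpace ℝ X] [FiniteDimensional ℝ X] (B : I → X →ₗ[ℝ] (Ω → ℝ)) (i : I)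
    (p : Ω) : Continuous fun x => B i x p :=
  ((LinearMap.proj p : (Ω → ℝ) →ₗ[ℝ] ℝ) ∘ₗ B i).continuous_of_finiteDimensional

section Smoothing

variable {Ω I X : Type*} [MeasurableSpace Ω] [NormedAddCommGroup X] [NormedSpace ℝ X]
  {ν : I → Measure Ω} [∀ i, IsFiniteMeasure (ν i)]
  {f : I → Ω → ℝ} {B : I → X →ₗ[ℝ] (Ω → ℝ)} {K : ℝ}

theorem BoundedFamily.integrable_family (h : BoundedFamily f B K) (i : I) (x : X) :
    Integrable (B i x) (ν i) :=
  integrable_of_measurable_of_abs_le (h.measurable_family i x) (h.family_le i x)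

/-- The integrals of the members of the family, as a linear function of the parameter. -/
noncomputable def BoundedFamily.integralMap (h : BoundedFamily f B K) (ν : I → Measure Ω)
    [∀ i, IsFiniteMeasure (ν i)] : X →ₗ[ℝ] (I → ℝ) where
  toFun x i := ∫ p, B i x p ∂ν i
  map_add' x y := by
    ext i
    simp only [map_add, Pi.add_apply]
    exact integral_add (h.integrable_family i x) (h.integrable_family i y)
  map_smul' r x := by
    ext i
    simp only [map_smul, Pi.smul_apply, RingHom.id_apply, smul_eq_mul]
    exact integral_const_mul r _

theorem BoundedFamily.integralMap_injective (h : BoundedFamily f B K) (hs : SignRich ν B)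
    (hν : ∀ i, ν i ≠ 0) : LinearMap.ker (h.integralMap ν) = ⊥ := by
  rw [LinearMap.ker_eq_bot']
  intro x hx
  by_contra hne
  obtain ⟨i, hi | hi⟩ := hs.exists_pos_or_neg x hne
  · exact (integral_pos_of_ae_pos (hν i) (h.integrable_family i x) hi).ne' (congrFun hx i)
  · have h1 := integral_pos_of_ae_pos (hν i) (h.integrable_family i x).neg
      (hi.mono fun p hp => by simpa using hp)
    have h2 : ∫ p, B i x p ∂ν i = 0 := congrFun hx i
    simp only [Pi.neg_apply, integral_neg, h2, neg_zero, lt_irrefl] at h1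

/-- The smoothed imbalance `∫ arctan (k (f - B x)) + (f - B x) / k` of the measures `ν i`. -/
noncomputable def BoundedFamily.imbalance (h : BoundedFamily f B K) (ν : I → Measure Ω)
    [∀ i, IsFiniteMeasure (ν i)] (k : ℝ) (x : X) (i : I) : ℝ :=
  (∫ p, Real.arctan (k * (f i p - B i x p)) ∂ν i) +
    ((∫ p, f i p ∂ν i) - h.integralMap ν x i) / k

theorem BoundedFamily.measurable_arctan (h : BoundedFamily f B K) (k : ℝ) (x : X) (i : I) :
    Measurable fun p => Real.arctan (k * (f i p - B i x p)) :=
  Real.continuous_arctan.measurable.comp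
    (((h.measurable_target i).sub (h.measurable_family i x)).const_mul k)

theorem BoundedFamily.continuous_imbalance [FiniteDimensional ℝ X] (h : BoundedFamily f B K)
    (k : ℝ) (i : I) : Continuous fun x => h.imbalance ν k x i := by
  refine Continuous.add ?_ (Continuous.div_const (Continuous.sub continuous_const ?_) k)
  · refine continuous_of_dominated (bound := fun _ => Real.pi / 2)
      (fun x => (h.measurable_arctan k x i).aestronglyMeasurable)
      (fun x => Eventually.of_forall fun p => abs_arctan_le _) (integrable_const _)
      (Eventually.of_forall fun p => ?_)
    exact Real.continuous_arctan.comp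
      (continuous_const.mul (continuous_const.sub (continuous_family_apply B i p)))
  · exact ((LinearMap.proj i : (I → ℝ) →ₗ[ℝ] ℝ) ∘ₗ
      h.integralMap ν).continuous_of_finiteDimensional

theorem BoundedFamily.hasDerivAt_imbalance (h : BoundedFamily f B K) (k : ℝ) (x g : X) (i : I) :
    HasDerivAt (fun δ : ℝ => h.imbalance ν k (x + δ • g) i)
      ((∫ p, 1 / (1 + (k * (f i p - B i x p)) ^ 2) * (k * -B i g p) ∂ν i) +
        -h.integralMap ν g i / k) 0 := by
  have hlin : HasDerivAt (fun δ : ℝ => ((∫ p, f i p ∂ν i) - h.integralMap ν (x + δ • g) i) / k)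
      (-h.integralMap ν g i / k) 0 := by
    have : (fun δ : ℝ => ((∫ p, f i p ∂ν i) - h.integralMap ν (x + δ • g) i) / k) =
        fun δ : ℝ => ((∫ p, f i p ∂ν i) - (h.integralMap ν x i + δ * h.integralMap ν g i)) / k := by
      ext δ
      simp
    rw [this]
    have h1 := (((hasDerivAt_id (0 : ℝ)).mul_const (h.integralMap ν g i)).const_add
      (h.integralMap ν x i)).const_sub (∫ p, f i p ∂ν i)
    simpa using h1.div_const k
  refine HasDerivAt.add ?_ hlin
  have key := hasDerivAt_integral_of_dominated_loc_of_deriv_le (μ := ν i) (x₀ := (0 : ℝ))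
    (s := Set.univ) (F := fun δ p => Real.arctan (k * (f i p - B i (x + δ • g) p)))
    (F' := fun δ p => 1 / (1 + (k * (f i p - B i (x + δ • g) p)) ^ 2) * (k * -B i g p))
    (bound := fun _ => |k| * (K * ‖g‖)) univ_mem
    (Eventually.of_forall fun δ => (h.measurable_arctan k _ i).aestronglyMeasurable)
    (integrable_of_measurable_of_abs_le (h.measurable_arctan k _ i) fun p => abs_arctan_le _)
    ?_ ?_ (integrable_const _) ?_
  · simpa using key.2
  · refine Measurable.aestronglyMeasurable ?_
    have := h.measurable_target i
    have := h.measurable_family i (x + (0 : ℝ) • g)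
    have := h.measurable_family i g
    fun_prop
  · refine Eventually.of_forall fun p δ _ => ?_
    rw [norm_mul, norm_mul, norm_neg, Real.norm_eq_abs, Real.norm_eq_abs, Real.norm_eq_abs]
    have h1 : |1 / (1 + (k * (f i p - B i (x + δ • g) p)) ^ 2)| ≤ 1 := by
      rw [abs_of_nonneg (by positivity), div_le_one (by positivity)]
      nlinarith [sq_nonneg (k * (f i p - B i (x + δ • g) p))]
    calc _ ≤ 1 * (|k| * |B i g p|) := by gcongr
      _ ≤ |k| * (K * ‖g‖) := by
        rw [one_mul]
        gcongr
        exact h.family_le i g p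
  · refine Eventually.of_forall fun p δ _ => HasDerivAt.arctan ?_
    have : (fun δ : ℝ => k * (f i p - B i (x + δ • g) p)) =
        fun δ : ℝ => k * (f i p - (B i x p + δ * B i g p)) := by
      ext δ
      simp
    rw [this]
    have h1 := (((hasDerivAt_id δ).mul_const (B i g p)).const_add (B i x p)).const_sub (f i p)
    simpa using h1.const_mul k

variable [FiniteDimensional ℝ X]

/-- Parameters at which the smoothed imbalances vanish do not escape to infinity as the smoothing
tends to zero: in a limiting direction `u`, some `B i u` would have a strict sign almost
everywhere, and the imbalance of `ν i` would eventually have the opposite sign. -/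
theorem BoundedFamily.not_tendsto_norm_atTop (h : BoundedFamily f B K) (hs : SignRich ν B)
    (hν : ∀ i, ν i ≠ 0) {x : ℕ → X} (hx : ∀ (n : ℕ) i, h.imbalance ν ((n : ℝ) + 1) (x n) i = 0) :
    ¬ Tendsto (fun n => ‖x n‖) atTop atTop := by
  intro hr
  obtain ⟨u, -, φ, hφ, hu⟩ := tendsto_subseq_of_bounded (x := fun n => ‖x n‖⁻¹ • x n)
    (Metric.isBounded_closedBall (x := (0 : X)) (r := 1)) fun n => by
      rw [mem_closedBall_zero_iff, norm_smul, norm_inv, norm_norm]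
      exact inv_mul_le_one
  have hrφ : Tendsto (fun n => ‖x (φ n)‖) atTop atTop := hr.comp hφ.tendsto_atTop
  have hpos : ∀ᶠ n in atTop, 0 < ‖x (φ n)‖ := hrφ.eventually_gt_atTop 0
  have hu1 : u ≠ 0 := by
    have h1 : Tendsto (fun n => ‖‖x (φ n)‖⁻¹ • x (φ n)‖) atTop (𝓝 1) := by
      refine tendsto_const_nhds.congr' ?_
      filter_upwards [hpos] with n hn
      rw [norm_smul, norm_inv, norm_norm, inv_mul_cancel₀ hn.ne']
    have h2 := tendsto_nhds_unique hu.norm h1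
    rintro rfl
    simp at h2
  obtain ⟨i, ε, hε, hsign⟩ : ∃ i, ∃ ε : ℝ, (ε = 1 ∨ ε = -1) ∧ ∀ᵐ p ∂ν i, 0 < ε * B i u p := by
    obtain ⟨i, hi | hi⟩ := hs.exists_pos_or_neg u hu1
    · exact ⟨i, 1, Or.inl rfl, by simpa using hi⟩
    · exact ⟨i, -1, Or.inr rfl, by simpa using hi⟩
  have hxu : ∀ᶠ n in atTop, x (φ n) = ‖x (φ n)‖ • (‖x (φ n)‖⁻¹ • x (φ n)) := by
    filter_upwards [hpos] with n hn
    rw [smul_smul, mul_inv_cancel₀ hn.ne', one_smul]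
  have hk : Tendsto (fun n => ((φ n : ℝ) + 1)) atTop atTop :=
    tendsto_atTop_add_const_right _ _ (tendsto_natCast_atTop_atTop.comp hφ.tendsto_atTop)
  have harctan : ∀ z, ε * Real.arctan z = Real.arctan (ε * z) := by
    rcases hε with rfl | rfl <;> simp
  -- the bounded part of the imbalance
  have h1 : Tendsto (fun n => ∫ p, ε * Real.arctan (((φ n : ℝ) + 1) *
      (f i p - B i (x (φ n)) p)) ∂ν i) atTop (𝓝 (∫ p, (-(Real.pi / 2)) ∂ν i)) := by
    refine tendsto_integral_of_dominated_convergence (fun _ => Real.pi / 2)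
      (fun n => ((h.measurable_arctan _ _ i).const_mul ε).aestronglyMeasurable)
      (integrable_const _) (fun n => Eventually.of_forall fun p => ?_) ?_
    · rw [harctan]
      exact abs_arctan_le _
    · filter_upwards [hsign] with p hp
      simp only [harctan]
      refine (tendsto_nhds_of_tendsto_nhdsWithin Real.tendsto_arctan_atBot).comp ?_
      have h2 : Tendsto (fun n => ε * (f i p / ‖x (φ n)‖ - B i (‖x (φ n)‖⁻¹ • x (φ n)) p))
          atTop (𝓝 (ε * (0 - B i u p))) :=
        ((tendsto_const_nhds.div_atTop hrφ).sub
          (((continuous_family_apply B i p).tendsto u).comp hu)).const_mul ε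
      have h3 := (hk.atTop_mul_atTop₀ hrφ).atTop_mul_neg (by linarith) h2
      refine h3.congr' ?_
      filter_upwards [hpos, hxu] with n hn hn'
      conv_rhs => rw [hn']
      rw [map_smul (B i) ‖x (φ n)‖]
      simp only [Pi.smul_apply, smul_eq_mul]
      field_simp
  -- the linear part of the imbalance
  have h2 : ∀ᶠ n in atTop,
      ε * (((∫ p, f i p ∂ν i) - h.integralMap ν (x (φ n)) i) / ((φ n : ℝ) + 1)) ≤ 0 := by
    have hLpos : 0 < ε * h.integralMap ν u i := by
      have h3 := integral_pos_of_ae_pos (hν i) ((h.integrable_family i u).const_mul ε) hsign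
      rwa [integral_const_mul] at h3
    have hLcont : Continuous fun y => h.integralMap ν y i :=
      ((LinearMap.proj i : (I → ℝ) →ₗ[ℝ] ℝ) ∘ₗ h.integralMap ν).continuous_of_finiteDimensional
    have h3 : Tendsto (fun n => ε * ((∫ p, f i p ∂ν i) / ‖x (φ n)‖ -
        h.integralMap ν (‖x (φ n)‖⁻¹ • x (φ n)) i)) atTop
          (𝓝 (ε * (0 - h.integralMap ν u i))) :=
      ((tendsto_const_nhds.div_atTop hrφ).sub ((hLcont.tendsto u).comp hu)).const_mul ε
    filter_upwards [h3.eventually_lt_const (u := 0) (by linarith), hpos, hxu] with n hn hn0 hn'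
    have h4 : ε * (((∫ p, f i p ∂ν i) - h.integralMap ν (x (φ n)) i) / ((φ n : ℝ) + 1)) =
        ‖x (φ n)‖ / ((φ n : ℝ) + 1) * (ε * ((∫ p, f i p ∂ν i) / ‖x (φ n)‖ -
          h.integralMap ν (‖x (φ n)‖⁻¹ • x (φ n)) i)) := by
      conv_lhs => rw [hn']
      rw [map_smul (h.integralMap ν) ‖x (φ n)‖]
      simp only [Pi.smul_apply, smul_eq_mul]
      field_simp
    rw [h4]
    exact mul_nonpos_of_nonneg_of_nonpos (by positivity) hn.le
  have h3 : ∫ p, (-(Real.pi / 2)) ∂ν i < 0 := by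
    have : 0 < ∫ p, Real.pi / 2 ∂ν i :=
      integral_pos_of_ae_pos (hν i) (integrable_const _)
        (Eventually.of_forall fun _ => by positivity)
    rw [integral_neg]
    linarith
  obtain ⟨n, hn1, hn2⟩ := ((h1.eventually_lt_const h3).and h2).exists
  have h4 := hx (φ n) i
  unfold imbalance at h4
  rw [integral_const_mul] at hn1
  have h5 := congrArg (fun z => ε * z) h4
  simp only [mul_add, mul_zero] at h5
  linarith

variable [Fintype I]

theorem BoundedFamily.tendsto_sum_sq_imbalance (h : BoundedFamily f B K) (hs : SignRich ν B)
    (hν : ∀ i, ν i ≠ 0) {k : ℝ} (hk : 0 < k) :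
    Tendsto (fun x => ∑ i, h.imbalance ν k x i ^ 2) (cocompact X) atTop := by
  obtain ⟨A, hA0, hA⟩ := (h.integralMap ν).exists_antilipschitzWith (h.integralMap_injective hs hν)
  have hL : Tendsto (fun x => ‖h.integralMap ν x‖) (cocompact X) atTop := by
    have h1 : Tendsto (fun x : X => (A : ℝ)⁻¹ * ‖x‖) (cocompact X) atTop :=
      (tendsto_norm_cocompact_atTop).const_mul_atTop (by positivity)
    refine tendsto_atTop_mono (fun x => ?_) h1
    have := hA.le_mul_dist x 0
    simp only [dist_zero_right, map_zero] at this
    rw [inv_mul_le_iff₀ (by exact_mod_cast hA0)]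
    exact this
  -- The part of the imbalance that is not linear in `x` is bounded by `D`.
  obtain ⟨D, hD⟩ : ∃ D : ℝ, ∀ x i, |h.imbalance ν k x i + h.integralMap ν x i / k| ≤ D := by
    refine ⟨∑ i, (Real.pi / 2 * (ν i).real Set.univ + |(∫ p, f i p ∂ν i) / k|), fun x i => ?_⟩
    have h1 : |∫ p, Real.arctan (k * (f i p - B i x p)) ∂ν i| ≤
        Real.pi / 2 * (ν i).real Set.univ := by
      rw [← Real.norm_eq_abs]
      exact norm_integral_le_of_norm_le_const (Eventually.of_forall fun p => abs_arctan_le _)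
    have h2 : h.imbalance ν k x i + h.integralMap ν x i / k =
        (∫ p, Real.arctan (k * (f i p - B i x p)) ∂ν i) + (∫ p, f i p ∂ν i) / k := by
      unfold imbalance
      ring
    rw [h2]
    refine (abs_add_le _ _).trans ((add_le_add_left h1 _).trans ?_)
    exact Finset.single_le_sum
      (f := fun i => Real.pi / 2 * (ν i).real Set.univ + |(∫ p, f i p ∂ν i) / k|)
      (fun j _ => by have := Real.pi_pos; positivity) (Finset.mem_univ i)
  have h3 : Tendsto (fun x => k⁻¹ * ‖h.integralMap ν x‖ - (|D| + 1)) (cocompact X) atTop :=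
    tendsto_atTop_add_const_right _ _ (hL.const_mul_atTop (by positivity))
  refine tendsto_atTop_mono' _ ?_ h3
  filter_upwards [h3.eventually_ge_atTop 1] with x hx
  have h4 : ‖h.integralMap ν x‖ ≤ k * (Real.sqrt (∑ i, h.imbalance ν k x i ^ 2) + |D|) := by
    refine (pi_norm_le_iff_of_nonneg (by positivity)).2 fun i => ?_
    have h5 : |h.imbalance ν k x i| ≤ Real.sqrt (∑ i, h.imbalance ν k x i ^ 2) :=
      Real.abs_le_sqrt (Finset.single_le_sum (f := fun i => h.imbalance ν k x i ^ 2)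
        (fun j _ => sq_nonneg _) (Finset.mem_univ i))
    have h6 : h.integralMap ν x i =
        k * ((h.imbalance ν k x i + h.integralMap ν x i / k) - h.imbalance ν k x i) := by
      field_simp
      ring
    rw [h6, Real.norm_eq_abs, abs_mul, abs_of_pos hk]
    gcongr
    refine (abs_sub _ _).trans ?_
    have := (hD x i).trans (le_abs_self D)
    linarith
  have h7 : k⁻¹ * ‖h.integralMap ν x‖ ≤ Real.sqrt (∑ i, h.imbalance ν k x i ^ 2) + |D| := by
    rwa [inv_mul_le_iff₀ hk]
  have h8 : 1 ≤ Real.sqrt (∑ i, h.imbalance ν k x i ^ 2) := by linarith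
  have h9 := Real.sq_sqrt (Finset.sum_nonneg fun i (_ : i ∈ Finset.univ) =>
    sq_nonneg (h.imbalance ν k x i))
  nlinarith

/-- The smoothed problem has a solution: at a minimum of the sum of the squares of the
imbalances, moving in a direction whose signs agree with those of the imbalances would decrease
that sum, unless all the imbalances vanish. -/
theorem BoundedFamily.exists_imbalance_eq_zero (h : BoundedFamily f B K) (hs : SignRich ν B)
    (hν : ∀ i, ν i ≠ 0) {k : ℝ} (hk : 0 < k) : ∃ x, ∀ i, h.imbalance ν k x i = 0 := by
  have hcont : Continuous fun x => ∑ i, h.imbalance ν k x i ^ 2 :=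
    continuous_finsetSum _ fun i _ => (h.continuous_imbalance k i).pow 2
  obtain ⟨x, hx⟩ := hcont.exists_forall_le (h.tendsto_sum_sq_imbalance hs hν hk)
  refine ⟨x, ?_⟩
  by_contra hne
  obtain ⟨g, hg, i₀, hi₀⟩ := hs.exists_of_signs (h.imbalance ν k x) fun h0 => hne (congrFun h0)
  have hder := HasDerivAt.fun_sum (u := Finset.univ) fun i _ =>
    (h.hasDerivAt_imbalance (ν := ν) k x g i).pow 2
  have hmin : IsLocalMin (fun δ : ℝ => ∑ i, h.imbalance ν k (x + δ • g) i ^ 2) 0 :=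
    Eventually.of_forall fun δ => by simpa using hx (x + δ • g)
  have h0 := hmin.hasDerivAt_eq_zero hder
  simp only [zero_smul, add_zero, Nat.cast_ofNat, Nat.add_one_sub_one, pow_one] at h0
  have hint : ∀ i, h.imbalance ν k x i * h.integralMap ν g i =
      ∫ p, h.imbalance ν k x i * B i g p ∂ν i := fun i => (integral_const_mul _ _).symm
  have hterm : ∀ i, 2 * h.imbalance ν k x i *
      ((∫ p, 1 / (1 + (k * (f i p - B i x p)) ^ 2) * (k * -B i g p) ∂ν i) +
        -h.integralMap ν g i / k) ≤ -(2 / k) * (h.imbalance ν k x i * h.integralMap ν g i) := by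
    intro i
    have h1 : h.imbalance ν k x i *
        (∫ p, 1 / (1 + (k * (f i p - B i x p)) ^ 2) * (k * -B i g p) ∂ν i) ≤ 0 := by
      rw [← integral_const_mul]
      refine integral_nonpos_of_ae ?_
      filter_upwards [hg i] with p hp
      have : h.imbalance ν k x i * (1 / (1 + (k * (f i p - B i x p)) ^ 2) * (k * -B i g p)) =
        -((1 / (1 + (k * (f i p - B i x p)) ^ 2) * k) * (h.imbalance ν k x i * B i g p)) := by
        ring
      rw [this]
      simp only [Pi.zero_apply, Left.neg_nonpos_iff]
      positivity
    have h2 : 2 * h.imbalance ν k x i * (-h.integralMap ν g i / k) =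
      -(2 / k) * (h.imbalance ν k x i * h.integralMap ν g i) := by ring
    rw [mul_add, h2]
    linarith
  have hle : ∀ i, -(2 / k) * (h.imbalance ν k x i * h.integralMap ν g i) ≤ 0 := fun i => by
    have : 0 ≤ h.imbalance ν k x i * h.integralMap ν g i := by
      rw [hint]
      exact integral_nonneg_of_ae (hg i)
    have hk2 : 0 < 2 / k := by positivity
    nlinarith
  have hlt : -(2 / k) * (h.imbalance ν k x i₀ * h.integralMap ν g i₀) < 0 := by
    have : 0 < h.imbalance ν k x i₀ * h.integralMap ν g i₀ := by
      rw [hint]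
      exact integral_pos_of_ae_pos (hν i₀) ((h.integrable_family i₀ g).const_mul _) hi₀
    have hk2 : 0 < 2 / k := by positivity
    nlinarith
  have hsum := Finset.sum_lt_sum (s := Finset.univ)
    (fun i _ => (hterm i).trans (hle i)) ⟨i₀, Finset.mem_univ _, (hterm i₀).trans_lt hlt⟩
  rw [h0] at hsum
  simp at hsum

theorem BoundedFamily.exists_bisecting (h : BoundedFamily f B K) (hs : SignRich ν B)
    (hν : ∀ i, ν i ≠ 0) (hne : ∀ i x, ∀ᵐ p ∂ν i, f i p ≠ B i x p) :
    ∃ x, ∀ i, ν i {p | B i x p < f i p} = ν i {p | f i p < B i x p} := by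
  have hk0 : ∀ n : ℕ, (0 : ℝ) < (n : ℝ) + 1 := fun n => by positivity
  choose x hx using fun n : ℕ => h.exists_imbalance_eq_zero hs hν (hk0 n)
  obtain ⟨R, hR⟩ : ∃ R, ∃ᶠ n in atTop, x n ∈ Metric.closedBall (0 : X) R := by
    by_contra hcon
    push Not at hcon
    refine h.not_tendsto_norm_atTop hs hν hx ((tendsto_atTop (f := atTop)).2 fun R => ?_)
    filter_upwards [hcon R] with n hn
    rw [mem_closedBall_zero_iff, not_le] at hn
    exact hn.le
  obtain ⟨a, -, φ, hφ, ha⟩ := tendsto_subseq_of_frequently_bounded Metric.isBounded_closedBall hR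
  refine ⟨a, fun i => ?_⟩
  have hmf := h.measurable_target i
  have hmB := h.measurable_family i a
  have hk : Tendsto (fun n => ((φ n : ℝ) + 1)) atTop atTop :=
    tendsto_atTop_add_const_right _ _ (tendsto_natCast_atTop_atTop.comp hφ.tendsto_atTop)
  have h1 : Tendsto (fun n => ∫ p, Real.arctan (((φ n : ℝ) + 1) *
      (f i p - B i (x (φ n)) p)) ∂ν i) atTop
      (𝓝 (∫ p, ({p | B i a p < f i p}.indicator (fun _ => Real.pi / 2) p -
        {p | f i p < B i a p}.indicator (fun _ => Real.pi / 2) p) ∂ν i)) := by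
    refine tendsto_integral_of_dominated_convergence (fun _ => Real.pi / 2)
      (fun n => (h.measurable_arctan _ _ i).aestronglyMeasurable)
      (integrable_const _) (fun n => Eventually.of_forall fun p => abs_arctan_le _) ?_
    filter_upwards [hne i a] with p hp
    have h2 : Tendsto (fun n => f i p - B i (x (φ n)) p) atTop (𝓝 (f i p - B i a p)) :=
      tendsto_const_nhds.sub (((continuous_family_apply B i p).tendsto a).comp ha)
    rcases lt_or_gt_of_ne hp with hlt | hgt
    · simp only [Set.indicator, Set.mem_ofPred_eq, hlt, hlt.le.not_gt, if_true, if_false, zero_sub]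
      exact (tendsto_nhds_of_tendsto_nhdsWithin Real.tendsto_arctan_atBot).comp
        (hk.atTop_mul_neg (sub_neg.2 hlt) h2)
    · simp only [Set.indicator, Set.mem_ofPred_eq, hgt, hgt.le.not_gt, if_true, if_false, sub_zero]
      exact (tendsto_nhds_of_tendsto_nhdsWithin Real.tendsto_arctan_atTop).comp
        (hk.atTop_mul_pos (sub_pos.2 hgt) h2)
  have h2 : Tendsto (fun n => ((∫ p, f i p ∂ν i) - h.integralMap ν (x (φ n)) i) /
      ((φ n : ℝ) + 1)) atTop (𝓝 0) := by
    have hLcont : Continuous fun y => h.integralMap ν y i :=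
      ((LinearMap.proj i : (I → ℝ) →ₗ[ℝ] ℝ) ∘ₗ h.integralMap ν).continuous_of_finiteDimensional
    exact (tendsto_const_nhds.sub ((hLcont.tendsto a).comp ha)).div_atTop hk
  have h3 := h1.add h2
  have h4 := tendsto_nhds_unique h3
    (tendsto_const_nhds.congr fun n => (hx (φ n) i).symm)
  have hm1 : MeasurableSet {p | B i a p < f i p} := measurableSet_lt hmB hmf
  have hm2 : MeasurableSet {p | f i p < B i a p} := measurableSet_lt hmf hmB
  rw [add_zero, integral_sub ((integrable_const _).indicator hm1)
    ((integrable_const _).indicator hm2), integral_indicator_const _ hm1,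
    integral_indicator_const _ hm2, ← sub_smul, smul_eq_mul, mul_eq_zero,
    or_iff_left (by positivity), sub_eq_zero] at h4
  exact (measureReal_eq_measureReal_iff).1 h4

end Smoothing

/-- Finitely many finite measures are bisected simultaneously by the graph of a member of a
sign-rich family. -/
theorem SignRich.exists_bisecting {Ω I X : Type*} [MeasurableSpace Ω] [Fintype I]
    [NormedAddCommGroup X] [NormedSpace ℝ X] [FiniteDimensional ℝ X]
    {ν : I → Measure Ω} [∀ i, IsFiniteMeasure (ν i)] {f : I → Ω → ℝ}
    {B : I → X →ₗ[ℝ] (Ω → ℝ)} (hs : SignRich ν B) (hν : ∀ i, ν i ≠ 0)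
    (hf : ∀ i, Measurable (f i)) (hB : ∀ i x, Measurable (B i x))
    (hne : ∀ i x, ∀ᵐ p ∂ν i, f i p ≠ B i x p) :
    ∃ x, ∀ i, ν i {p | B i x p < f i p} = ν i {p | f i p < B i x p} := by
  let b := Module.finBasis ℝ X
  -- Dividing all functions by the positive weight `w i` makes them bounded and changes neither
  -- signs nor comparisons.
  let w : I → Ω → ℝ := fun i p => 1 + |f i p| + ∑ j, |B i (b j) p|
  have hw : ∀ i p, 0 < w i p := fun i p => by positivity
  have hwm : ∀ i, Measurable (w i) := fun i => by
    have := hf i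
    have := fun j => hB i (b j)
    fun_prop
  let B' : I → X →ₗ[ℝ] (Ω → ℝ) := fun i =>
    { toFun := fun x p => B i x p / w i p
      map_add' := fun x y => by ext p; simp [add_div]
      map_smul' := fun r x => by ext p; simp [mul_div_assoc] }
  have hB' : ∀ i x p, B' i x p = B i x p / w i p := fun _ _ _ => rfl
  obtain ⟨K, hK0, hK⟩ : ∃ K > 0, ∀ x j, |b.repr x j| ≤ K * ‖x‖ := by
    obtain ⟨K, hK0, hK⟩ := (LinearMap.toContinuousLinearMap
      b.equivFun.toLinearMap).isBoundedLinearMap.bound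
    exact ⟨K, hK0, fun x j => (norm_le_pi_norm (b.equivFun x) j).trans (hK x)⟩
  have hbdd : BoundedFamily (fun i p => f i p / w i p) B' K := by
    refine ⟨fun i => (hf i).div (hwm i), fun i x => (hB i x).div (hwm i), fun i p => ?_,
      fun i x p => ?_⟩
    · rw [abs_div, abs_of_pos (hw i p), div_le_one (hw i p)]
      have : 0 ≤ ∑ j, |B i (b j) p| := by positivity
      simp only [w]
      linarith
    · rw [hB', abs_div, abs_of_pos (hw i p), div_le_iff₀ (hw i p)]
      have h1 : B i x p = ∑ j, b.repr x j * B i (b j) p := by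
        have h0 := congrArg (fun y => B i y p) (b.sum_repr x)
        simp only [map_sum, map_smul, Finset.sum_apply, Pi.smul_apply, smul_eq_mul] at h0
        exact h0.symm
      have h2 : |B i x p| ≤ ∑ j, K * ‖x‖ * |B i (b j) p| := by
        rw [h1]
        refine (Finset.abs_sum_le_sum_abs _ _).trans (Finset.sum_le_sum fun j _ => ?_)
        rw [abs_mul]
        gcongr
        exact hK x j
      refine h2.trans ?_
      rw [← Finset.mul_sum]
      refine mul_le_mul_of_nonneg_left ?_ (by positivity)
      change _ ≤ 1 + |f i p| + _
      have := abs_nonneg (f i p)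
      linarith
  have hs' : SignRich ν B' := by
    refine ⟨fun x hx => ?_, fun s hs0 => ?_⟩
    · obtain ⟨i, hi | hi⟩ := hs.exists_pos_or_neg x hx
      · exact ⟨i, Or.inl (hi.mono fun p hp => div_pos hp (hw i p))⟩
      · exact ⟨i, Or.inr (hi.mono fun p hp => div_neg_of_neg_of_pos hp (hw i p))⟩
    · obtain ⟨x, hx, i, hi⟩ := hs.exists_of_signs s hs0
      refine ⟨x, fun j => (hx j).mono fun p hp => ?_, i, hi.mono fun p hp => ?_⟩
      · rw [hB', ← mul_div_assoc]
        exact div_nonneg hp (hw j p).le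
      · rw [hB', ← mul_div_assoc]
        exact div_pos hp (hw i p)
  obtain ⟨x, hx⟩ := hbdd.exists_bisecting hs' hν fun i x => (hne i x).mono fun p hp => by
    rw [hB', Ne, div_left_inj' (hw i p).ne']
    exact hp
  refine ⟨x, fun i => ?_⟩
  have := hx i
  simpa only [hB', div_lt_div_iff_of_pos_right (hw i _)] using this

/-! ### Cells indexed by lists of signs -/

/-- The sign `±1` encoded by a Boolean. -/
def sgn (s : Bool) : ℝ := if s then 1 else -1

theorem sgn_not (s : Bool) : sgn (!s) = -sgn s := by cases s <;> simp [sgn]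

theorem sgn_mul_self (s : Bool) : sgn s * sgn s = 1 := by cases s <;> simp [sgn]

theorem exists_sgn_mul_eq_abs (r : ℝ) : ∃ s, sgn s * r = |r| := by
  rcases le_total 0 r with h | h
  · exact ⟨true, by simp [sgn, abs_of_nonneg h]⟩
  · exact ⟨false, by simp [sgn, abs_of_nonpos h]⟩

section Cells

variable {V E : Type*} [AddCommGroup V] [Module ℝ V] [AddTorsor V E]

/-- The cell of a list of signs for a tree `Φ` of affine functionals. Lists are read from the
tail: the head is the most recent sign, and the proper suffixes of a list are the nodes on the
way to it. -/
def cell (Φ : List Bool → E →ᵃ[ℝ] ℝ) : List Bool → Set E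
  | [] => Set.univ
  | s :: τ => cell Φ τ ∩ {p | 0 ≤ sgn s * Φ τ p}

/-- The affine functional `c + ∑ a ρ • Φ ρ`, the sum being over the proper suffixes `ρ` of a list
of signs. -/
noncomputable def pathSum (Φ : List Bool → E →ᵃ[ℝ] ℝ) (c : ℝ) (a : List Bool → ℝ) :
    List Bool → E →ᵃ[ℝ] ℝ
  | [] => AffineMap.const ℝ E c
  | _ :: τ => pathSum Φ c a τ + a τ • Φ τ

theorem pathSum_cons_apply (Φ : List Bool → E →ᵃ[ℝ] ℝ) (c : ℝ) (a : List Bool → ℝ) (s : Bool)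
    (τ : List Bool) (p : E) :
    pathSum Φ c a (s :: τ) p = pathSum Φ c a τ p + a τ * Φ τ p := rfl

theorem exists_cons_suffix {τ σ : List Bool} (h : τ <:+ σ) (hlt : τ.length < σ.length) :
    ∃ s, (s :: τ) <:+ σ := by
  obtain ⟨t, rfl⟩ := h
  have ht : t ≠ [] := by
    rintro rfl
    simp at hlt
  refine ⟨t.getLast ht, t.dropLast, ?_⟩
  conv_rhs => rw [← List.dropLast_append_getLast ht]
  simp

theorem cell_subset_of_suffix (Φ : List Bool → E →ᵃ[ℝ] ℝ) {τ σ : List Bool} (h : τ <:+ σ) :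
    cell Φ σ ⊆ cell Φ τ := by
  induction σ with
  | nil => rw [List.suffix_nil.1 h]
  | cons s ρ ih =>
    rcases List.suffix_cons_iff.1 h with rfl | h
    · exact subset_rfl
    · exact Set.inter_subset_left.trans (ih h)

theorem cell_sign {Φ : List Bool → E →ᵃ[ℝ] ℝ} {s : Bool} {τ σ : List Bool}
    (h : (s :: τ) <:+ σ) {p : E} (hp : p ∈ cell Φ σ) : 0 ≤ sgn s * Φ τ p :=
  (cell_subset_of_suffix Φ h hp).2

theorem mem_cell_iff {Φ : List Bool → E →ᵃ[ℝ] ℝ} {σ : List Bool} {p : E} :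
    p ∈ cell Φ σ ↔ ∀ s τ, (s :: τ) <:+ σ → 0 ≤ sgn s * Φ τ p := by
  refine ⟨fun hp s τ h => cell_sign h hp, fun h => ?_⟩
  induction σ with
  | nil => trivial
  | cons s ρ ih =>
    exact ⟨ih fun t τ ht => h t τ (ht.trans (List.suffix_cons s ρ)), h s ρ List.suffix_rfl⟩

theorem cell_congr {Φ Φ' : List Bool → E →ᵃ[ℝ] ℝ} {σ : List Bool}
    (h : ∀ τ : List Bool, τ.length < σ.length → Φ τ = Φ' τ) : cell Φ σ = cell Φ' σ := by
  induction σ with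
  | nil => rfl
  | cons s τ ih =>
    have h1 := ih fun ρ hρ => h ρ (hρ.trans (by simp))
    simp only [cell, h1, h τ (by simp)]

theorem pathSum_congr {Φ Φ' : List Bool → E →ᵃ[ℝ] ℝ} {σ : List Bool} (c : ℝ)
    (a : List Bool → ℝ) (h : ∀ τ : List Bool, τ.length < σ.length → Φ τ = Φ' τ) :
    pathSum Φ c a σ = pathSum Φ' c a σ := by
  induction σ with
  | nil => rfl
  | cons s τ ih =>
    have h1 := ih fun ρ hρ => h ρ (hρ.trans (by simp))
    simp only [pathSum, h1, h τ (by simp)]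

theorem pathSum_neg (Φ : List Bool → E →ᵃ[ℝ] ℝ) (c : ℝ) (a : List Bool → ℝ) (σ : List Bool)
    (p : E) : pathSum Φ (-c) (fun τ => -a τ) σ p = -pathSum Φ c a σ p := by
  induction σ with
  | nil => simp [pathSum]
  | cons s τ ih =>
    simp only [pathSum_cons_apply, ih]
    ring

theorem pathSum_eq_const (Φ : List Bool → E →ᵃ[ℝ] ℝ) (c : ℝ) {a : List Bool → ℝ}
    {σ : List Bool} (h : ∀ s τ, (s :: τ) <:+ σ → a τ = 0) (p : E) : pathSum Φ c a σ p = c := by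
  induction σ with
  | nil => simp [pathSum]
  | cons s τ ih =>
    have h1 := ih fun t ρ ht => h t ρ (ht.trans (List.suffix_cons s τ))
    simp [pathSum, h1, h s τ List.suffix_rfl]

theorem pathSum_single (Φ : List Bool → E →ᵃ[ℝ] ℝ) {a : List Bool → ℝ} {ρ σ : List Bool}
    {s : Bool} (ha : ∀ τ, τ ≠ ρ → a τ = 0) (h : (s :: ρ) <:+ σ) (p : E) :
    pathSum Φ 0 a σ p = a ρ * Φ ρ p := by
  induction σ with
  | nil => simp at h
  | cons t τ ih =>
    rcases List.suffix_cons_iff.1 h with heq | h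
    · obtain ⟨rfl, rfl⟩ := List.cons.inj heq
      have h1 : pathSum Φ 0 a ρ p = 0 := pathSum_eq_const Φ 0 (fun s' τ' h' => ha _ (by
        rintro rfl
        simpa using h'.length_le)) p
      simp [pathSum, h1]
    · have hne : τ ≠ ρ := by
        rintro rfl
        simpa using h.length_le
      simp [pathSum, ih h, ha τ hne]

/-- Choosing the signs greedily, every node extends to a cell on which the path sum is at least
its value at the node. -/
theorem exists_cell_pathSum_le (Φ : List Bool → E →ᵃ[ℝ] ℝ) (c : ℝ) (a : List Bool → ℝ)
    {τ : List Bool} {m : ℕ} (hm : τ.length ≤ m) :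
    ∃ σ : List Bool, σ.length = m ∧ τ <:+ σ ∧
      ∀ p ∈ cell Φ σ, pathSum Φ c a τ p ≤ pathSum Φ c a σ p := by
  induction m, hm using Nat.le_induction with
  | base => exact ⟨τ, rfl, List.suffix_rfl, fun p _ => le_rfl⟩
  | succ m _ ih =>
    obtain ⟨σ, hσ, hτ, hle⟩ := ih
    obtain ⟨s, hs⟩ := exists_sgn_mul_eq_abs (a σ)
    refine ⟨s :: σ, by simp [hσ], hτ.trans (List.suffix_cons s σ), fun p hp => ?_⟩
    have h1 : a σ * Φ σ p = |a σ| * (sgn s * Φ σ p) := by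
      rw [← hs]
      linear_combination (-(a σ * Φ σ p)) * sgn_mul_self s
    have h2 : 0 ≤ |a σ| * (sgn s * Φ σ p) := mul_nonneg (abs_nonneg _) hp.2
    have h3 := hle p hp.1
    simp only [pathSum_cons_apply]
    linarith

/-- A pattern of signs on the leaves of a binary tree either has constant sign, or there is a
node below whose two children it has opposite constant signs, without vanishing below the node. -/
theorem sign_dichotomy {m : ℕ} (S : List Bool → ℝ) (k : ℕ) (τ : List Bool)
    (hk : τ.length + k = m) :
    (∀ σ : List Bool, σ.length = m → τ <:+ σ → 0 ≤ S σ) ∨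
    (∀ σ : List Bool, σ.length = m → τ <:+ σ → S σ ≤ 0) ∨
    ∃ (ρ : List Bool) (t : Bool), ρ.length < m ∧
      (∀ σ : List Bool, σ.length = m → (t :: ρ) <:+ σ → 0 ≤ S σ) ∧
      (∀ σ : List Bool, σ.length = m → ((!t) :: ρ) <:+ σ → S σ ≤ 0) ∧
      ∃ σ : List Bool, σ.length = m ∧ ρ <:+ σ ∧ S σ ≠ 0 := by
  induction k generalizing τ with
  | zero =>
    have h : ∀ σ : List Bool, σ.length = m → τ <:+ σ → σ = τ := fun σ hσ h =>
      (h.eq_of_length (by omega)).symm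
    rcases le_total 0 (S τ) with h0 | h0
    · exact Or.inl fun σ hσ hτ => by rwa [h σ hσ hτ]
    · exact Or.inr (Or.inl fun σ hσ hτ => by rwa [h σ hσ hτ])
  | succ k ih =>
    have hsplit : ∀ (Q : ℝ → Prop),
        (∀ σ : List Bool, σ.length = m → (true :: τ) <:+ σ → Q (S σ)) →
        (∀ σ : List Bool, σ.length = m → (false :: τ) <:+ σ → Q (S σ)) →
        ∀ σ : List Bool, σ.length = m → τ <:+ σ → Q (S σ) := by
      intro Q ht hf σ hσ hτ
      obtain ⟨s, hs⟩ := exists_cons_suffix hτ (by omega)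
      cases s
      · exact hf σ hσ hs
      · exact ht σ hσ hs
    have hnode : ∀ t : Bool,
        (∀ σ : List Bool, σ.length = m → (t :: τ) <:+ σ → 0 ≤ S σ) →
        (∀ σ : List Bool, σ.length = m → ((!t) :: τ) <:+ σ → S σ ≤ 0) →
        (∀ σ : List Bool, σ.length = m → τ <:+ σ → 0 ≤ S σ) ∨
        ∃ (ρ : List Bool) (t : Bool), ρ.length < m ∧
          (∀ σ : List Bool, σ.length = m → (t :: ρ) <:+ σ → 0 ≤ S σ) ∧
          (∀ σ : List Bool, σ.length = m → ((!t) :: ρ) <:+ σ → S σ ≤ 0) ∧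
          ∃ σ : List Bool, σ.length = m ∧ ρ <:+ σ ∧ S σ ≠ 0 := by
      intro t h1 h2
      by_cases h : ∀ σ : List Bool, σ.length = m → τ <:+ σ → S σ = 0
      · exact Or.inl fun σ hσ hτ => (h σ hσ hτ).ge
      · push Not at h
        exact Or.inr ⟨τ, t, by omega, h1, h2, h⟩
    rcases ih (true :: τ) (by simp; omega) with ht | ht | ht
    · rcases ih (false :: τ) (by simp; omega) with hf | hf | hf
      · exact Or.inl (hsplit (0 ≤ ·) ht hf)
      · exact (hnode true ht hf).imp_right Or.inr
      · exact Or.inr (Or.inr hf)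
    · rcases ih (false :: τ) (by simp; omega) with hf | hf | hf
      · exact (hnode false hf ht).imp_right Or.inr
      · exact Or.inr (Or.inl (hsplit (· ≤ 0) ht hf))
      · exact Or.inr (Or.inr hf)
    · exact Or.inr (Or.inr ht)

end Cells

section Bisection

variable {V E : Type*} [AddCommGroup V] [Module ℝ V] [AddTorsor V E]

/-- Extension by zero of coefficients indexed by the lists of length less than `m`. -/
noncomputable def extendCoeff {m : ℕ} (a : {l : List Bool // l.length < m} → ℝ)
    (τ : List Bool) : ℝ :=
  if h : τ.length < m then a ⟨τ, h⟩ else 0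

/-- Path sums along the lists of length `m`, as functions depending linearly on the
coefficients. -/
noncomputable def pathFamily (Φ : List Bool → E →ᵃ[ℝ] ℝ) {m : ℕ} (σ : List Bool) :
    (ℝ × ({l : List Bool // l.length < m} → ℝ)) →ₗ[ℝ] (E → ℝ) where
  toFun x p := pathSum Φ x.1 (extendCoeff x.2) σ p
  map_add' x y := by
    ext p
    induction σ with
    | nil => simp [pathSum]
    | cons s τ ih =>
      have h : extendCoeff (x.2 + y.2) τ = extendCoeff x.2 τ + extendCoeff y.2 τ := by
        unfold extendCoeff
        split_ifs <;> simp
      simp only [Pi.add_apply, Prod.fst_add, Prod.snd_add] at ih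
      simp only [pathSum_cons_apply, Prod.fst_add,
        Prod.snd_add, Pi.add_apply, ih, h]
      ring
  map_smul' r x := by
    ext p
    induction σ with
    | nil => simp [pathSum]
    | cons s τ ih =>
      have h : extendCoeff (r • x.2) τ = r * extendCoeff x.2 τ := by
        unfold extendCoeff
        split_ifs <;> simp
      simp only [Pi.smul_apply, Prod.smul_fst, Prod.smul_snd, smul_eq_mul,
        RingHom.id_apply] at ih
      simp only [pathSum_cons_apply, smul_eq_mul, Prod.smul_fst,
        Prod.smul_snd, Pi.smul_apply, RingHom.id_apply, ih, h]
      ring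

variable [MeasurableSpace E]

theorem signRich_pathFamily {μ : Measure E} {Φ : List Bool → E →ᵃ[ℝ] ℝ} {m : ℕ}
    (hmeas : ∀ σ, MeasurableSet (cell Φ σ))
    (hnull : ∀ τ : List Bool, τ.length < m → ∀ᵐ p ∂μ, Φ τ p ≠ 0) :
    SignRich (fun σ : {σ : List Bool // σ.length = m} => μ.restrict (cell Φ σ.1))
      (fun σ => pathFamily (m := m) Φ σ.1) := by
  have hnull' : ∀ τ : List Bool, τ.length < m → ∀ S : Set E, ∀ᵐ p ∂μ.restrict S, Φ τ p ≠ 0 :=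
    fun τ hτ S => ae_restrict_of_ae (hnull τ hτ)
  refine ⟨?_, ?_⟩
  · rintro ⟨c, a⟩ hne
    rcases lt_trichotomy c 0 with hc | rfl | hc
    · obtain ⟨σ, hσ, -, hle⟩ := exists_cell_pathSum_le Φ (-c) (fun τ => -extendCoeff a τ)
        (τ := []) (Nat.zero_le m)
      refine ⟨⟨σ, hσ⟩, Or.inr (ae_restrict_of_forall_mem (hmeas σ) fun p hp => ?_)⟩
      have h1 := hle p hp
      rw [pathSum_neg, pathSum_neg] at h1
      have h2 : pathSum Φ c (extendCoeff a) [] p = c := rfl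
      change pathSum Φ c (extendCoeff a) σ p < 0
      linarith
    · obtain ⟨l, hl⟩ : ∃ l, a l ≠ 0 := by
        by_contra hcon
        push Not at hcon
        exact hne (Prod.ext rfl (funext hcon))
      -- a node of least depth at which the coefficient does not vanish
      obtain ⟨τ, hτ, hmin⟩ : ∃ τ, extendCoeff a τ ≠ 0 ∧
          ∀ ρ : List Bool, ρ.length < τ.length → extendCoeff a ρ = 0 := by
        have hex : ∃ k : ℕ, ∃ τ : List Bool, τ.length = k ∧ extendCoeff a τ ≠ 0 :=
          ⟨_, l.1, rfl, by simpa [extendCoeff, l.2] using hl⟩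
        classical
        obtain ⟨τ, hτ, h0⟩ := Nat.find_spec hex
        refine ⟨τ, h0, fun ρ hρ => ?_⟩
        by_contra h1
        exact Nat.find_min hex (hτ ▸ hρ) ⟨ρ, rfl, h1⟩
      have hτm : τ.length < m := by
        by_contra h
        exact hτ (by simp [extendCoeff, h])
      obtain ⟨s, hs⟩ := exists_sgn_mul_eq_abs (extendCoeff a τ)
      obtain ⟨σ, hσ, hsuf, hle⟩ := exists_cell_pathSum_le Φ 0 (extendCoeff a)
        (τ := s :: τ) (m := m) hτm
      refine ⟨⟨σ, hσ⟩, Or.inl ?_⟩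
      filter_upwards [ae_restrict_mem (hmeas σ), hnull' τ hτm _] with p hp hp0
      refine lt_of_lt_of_le ?_ (hle p hp)
      have h1 : pathSum Φ 0 (extendCoeff a) τ p = 0 := pathSum_eq_const Φ 0
        (fun t ρ h => hmin ρ (by simpa using h.length_le)) p
      simp only [pathSum_cons_apply, h1, zero_add]
      have h2 : extendCoeff a τ * Φ τ p = |extendCoeff a τ| * (sgn s * Φ τ p) := by
        rw [← hs]
        linear_combination (-(extendCoeff a τ * Φ τ p)) * sgn_mul_self s
      rw [h2]
      have h3 : sgn s ≠ 0 := by cases s <;> simp [sgn]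
      exact mul_pos (abs_pos.2 hτ) ((cell_sign hsuf hp).lt_of_ne (mul_ne_zero h3 hp0).symm)
    · obtain ⟨σ, hσ, -, hle⟩ := exists_cell_pathSum_le Φ c (extendCoeff a)
        (τ := []) (Nat.zero_le m)
      refine ⟨⟨σ, hσ⟩, Or.inl (ae_restrict_of_forall_mem (hmeas σ) fun p hp => ?_)⟩
      exact lt_of_lt_of_le hc (hle p hp)
  · intro S hS
    obtain ⟨i₀, hi₀⟩ : ∃ i, S i ≠ 0 := by
      by_contra hcon
      push Not at hcon
      exact hS (funext hcon)
    -- constant functions deal with patterns of constant sign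
    have hconst : ∀ r : ℝ, (∀ i, 0 ≤ S i * r) → r ≠ 0 →
        ∃ x, (∀ i, ∀ᵐ p ∂μ.restrict (cell Φ i.1), 0 ≤ S i * pathFamily (m := m) Φ i.1 x p) ∧
          ∃ i, ∀ᵐ p ∂μ.restrict (cell Φ i.1), 0 < S i * pathFamily (m := m) Φ i.1 x p := by
      intro r hr hr0
      have h1 : ∀ (i : {σ : List Bool // σ.length = m}) p, pathFamily (m := m) Φ i.1 (r, 0) p = r :=
        fun i p => pathSum_eq_const Φ r (fun _ _ _ => by simp [extendCoeff]) p
      refine ⟨(r, 0), fun i => Eventually.of_forall fun p => ?_, i₀,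
        Eventually.of_forall fun p => ?_⟩
      · rw [h1]
        exact hr i
      · rw [h1]
        exact (hr i₀).lt_of_ne (mul_ne_zero hi₀ hr0).symm
    let S' : List Bool → ℝ := fun σ => if h : σ.length = m then S ⟨σ, h⟩ else 0
    have hS' : ∀ i : {σ : List Bool // σ.length = m}, S' i.1 = S i := fun i => by simp [S', i.2]
    rcases sign_dichotomy (m := m) S' m [] (by simp) with
      h | h | ⟨ρ, t, hρ, hpos, hneg, σ, hσ, hρσ, hne⟩
    · exact hconst 1 (fun i => by simpa [hS'] using h i.1 i.2 (List.nil_suffix)) one_ne_zero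
    · exact hconst (-1) (fun i => by simpa [hS'] using h i.1 i.2 (List.nil_suffix)) (by norm_num)
    · classical
      let a : {l : List Bool // l.length < m} → ℝ := Pi.single ⟨ρ, hρ⟩ (sgn t)
      have haρ : extendCoeff a ρ = sgn t := by simp [extendCoeff, hρ, a]
      have ha : ∀ τ, τ ≠ ρ → extendCoeff a τ = 0 := fun τ hτ => by
        unfold extendCoeff
        split_ifs with h
        · exact Pi.single_eq_of_ne (fun h' => hτ (congrArg Subtype.val h')) _
        · rfl
      have hval : ∀ (i : {σ : List Bool // σ.length = m}) (s : Bool) p, (s :: ρ) <:+ i.1 →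
          pathFamily (m := m) Φ i.1 (0, a) p = sgn t * Φ ρ p := fun i s p h => by
        rw [← haρ]
        exact pathSum_single Φ ha h p
      have hnonneg : ∀ (i : {σ : List Bool // σ.length = m}), ∀ p ∈ cell Φ i.1,
          0 ≤ S i * pathFamily (m := m) Φ i.1 (0, a) p := by
        intro i p hp
        by_cases h : ∃ s, (s :: ρ) <:+ i.1
        · obtain ⟨s, hs⟩ := h
          rw [hval i s p hs, ← hS' i]
          have h1 := cell_sign hs hp
          rcases eq_or_ne s t with rfl | hst
          · exact mul_nonneg (hpos i.1 i.2 hs) h1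
          · obtain rfl : s = !t := by cases s <;> cases t <;> simp_all
            rw [sgn_not] at h1
            exact mul_nonneg_of_nonpos_of_nonpos (hneg i.1 i.2 hs) (by linarith)
        · have h1 : pathFamily (m := m) Φ i.1 (0, a) p = 0 :=
            pathSum_eq_const Φ 0 (fun s τ hs => ha τ (by
              rintro rfl
              exact h ⟨s, hs⟩)) p
          rw [h1, mul_zero]
      refine ⟨(0, a), fun i => ae_restrict_of_forall_mem (hmeas i.1) (hnonneg i), ⟨σ, hσ⟩, ?_⟩
      filter_upwards [ae_restrict_mem (hmeas σ), hnull' ρ hρ _] with p hp hp0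
      obtain ⟨s, hs⟩ := exists_cons_suffix hρσ (by omega)
      refine (hnonneg ⟨σ, hσ⟩ p hp).lt_of_ne (Ne.symm (mul_ne_zero ?_ ?_))
      · rw [← hS']
        exact hne
      · rw [hval ⟨σ, hσ⟩ s p hs]
        exact mul_ne_zero (by cases t <;> simp [sgn]) hp0

/-- The cells of a given depth can be bisected simultaneously by the graphs of the path sums of
a single system of coefficients. -/
theorem exists_pathSum_bisecting {μ : Measure E} [IsFiniteMeasure μ]
    {Φ : List Bool → E →ᵃ[ℝ] ℝ} {m : ℕ} {f : E →ᵃ[ℝ] ℝ}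
    (hmeas : ∀ g : E →ᵃ[ℝ] ℝ, Measurable g)
    (hcell : ∀ σ : List Bool, σ.length = m → μ (cell Φ σ) ≠ 0)
    (hnull : ∀ τ : List Bool, τ.length < m → ∀ᵐ p ∂μ, Φ τ p ≠ 0)
    (hf : ∀ σ : List Bool, σ.length = m → ∀ c a, ∀ᵐ p ∂μ, f p ≠ pathSum Φ c a σ p) :
    ∃ c a, ∀ σ : List Bool, σ.length = m →
      μ (cell Φ σ ∩ {p | pathSum Φ c a σ p < f p}) =
        μ (cell Φ σ ∩ {p | f p < pathSum Φ c a σ p}) := by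
  have hcm : ∀ σ, MeasurableSet (cell Φ σ) := by
    intro σ
    induction σ with
    | nil => exact MeasurableSet.univ
    | cons s τ ih =>
      exact ih.inter (measurableSet_le measurable_const ((hmeas (Φ τ)).const_mul _))
  have : Finite {l : List Bool // l.length < m} := List.finite_length_lt Bool m
  have : Fintype {l : List Bool // l.length < m} := Fintype.ofFinite _
  have : Fintype {σ : List Bool // σ.length = m} :=
    inferInstanceAs (Fintype (List.Vector Bool m))
  obtain ⟨x, hx⟩ := (signRich_pathFamily hcm hnull).exists_bisecting
    (f := fun _ => f)
    (fun σ => by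
      rw [Ne, Measure.restrict_eq_zero]
      exact hcell σ.1 σ.2)
    (fun _ => hmeas f) (fun σ x => hmeas (pathSum Φ x.1 (extendCoeff x.2) σ.1))
    (fun σ x => ae_restrict_of_ae (hf σ.1 σ.2 x.1 (extendCoeff x.2)))
  refine ⟨x.1, extendCoeff x.2, fun σ hσ => ?_⟩
  have h : μ.restrict (cell Φ σ) {p | pathSum Φ x.1 (extendCoeff x.2) σ p < f p} =
      μ.restrict (cell Φ σ) {p | f p < pathSum Φ x.1 (extendCoeff x.2) σ p} := hx ⟨σ, hσ⟩
  have hmp := hmeas (pathSum Φ x.1 (extendCoeff x.2) σ)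
  rw [Measure.restrict_apply (measurableSet_lt hmp (hmeas f)),
    Measure.restrict_apply (measurableSet_lt (hmeas f) hmp)] at h
  rw [Set.inter_comm, Set.inter_comm (cell Φ σ)]
  exact h

end Bisection

/-! ### Triangular charts and equipartition into cells -/

section Charts

variable {V E : Type*} [AddCommGroup V] [Module ℝ V] [AddTorsor V E]

/-- Affine coordinates `ξ 0, …, ξ (n - 1)` of an `n`-dimensional affine space, together with the
vectors `e 0, …, e (n - 1)` dual to them. -/
structure IsCoordinateSystem (n : ℕ) (ξ : ℕ → E →ᵃ[ℝ] ℝ) (e : ℕ → V) : Prop where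
  finrank_eq : Module.finrank ℝ V = n
  dual : ∀ i < n, ∀ j < n, (ξ i).linear (e j) = if i = j then 1 else 0

variable (V E) in
theorem exists_isCoordinateSystem [FiniteDimensional ℝ V] :
    ∃ (ξ : ℕ → E →ᵃ[ℝ] ℝ) (e : ℕ → V), IsCoordinateSystem (Module.finrank ℝ V) ξ e := by
  obtain ⟨o⟩ : Nonempty E := inferInstance
  let b := Module.finBasis ℝ V
  refine ⟨fun i => if h : i < Module.finrank ℝ V then
      (b.coord ⟨i, h⟩).toAffineMap.comp (AffineEquiv.vaddConst ℝ o).symm.toAffineMap else 0,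
    fun j => if h : j < Module.finrank ℝ V then b ⟨j, h⟩ else 0, rfl, fun i hi j hj => ?_⟩
  simp only [hi, hj, dif_pos, AffineMap.comp_linear, LinearMap.toAffineMap_linear]
  simp [Finsupp.single_apply, eq_comm]

/-- The path sums `c m + ∑ a m ρ • chart ρ` subtracted from the coordinate `ξ m`, by recursion
along the list. -/
noncomputable def chartOffset (ξ : ℕ → E →ᵃ[ℝ] ℝ) (c : ℕ → ℝ) (a : ℕ → List Bool → ℝ) :
    List Bool → ℕ → E →ᵃ[ℝ] ℝ
  | [], m => AffineMap.const ℝ E (c m)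
  | _ :: τ, m => chartOffset ξ c a τ m + a m τ • (ξ τ.length - chartOffset ξ c a τ τ.length)

/-- The triangular system of charts attached to the coefficients `c` and `a`: the chart at a node
`τ` of depth `m` is `ξ m - c m - ∑ a m ρ • chart ρ`, the sum being over the proper suffixes `ρ`
of `τ`. -/
noncomputable def chart (ξ : ℕ → E →ᵃ[ℝ] ℝ) (c : ℕ → ℝ) (a : ℕ → List Bool → ℝ)
    (τ : List Bool) : E →ᵃ[ℝ] ℝ :=
  ξ τ.length - chartOffset ξ c a τ τ.length

theorem chartOffset_eq_pathSum (ξ : ℕ → E →ᵃ[ℝ] ℝ) (c : ℕ → ℝ) (a : ℕ → List Bool → ℝ)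
    (τ : List Bool) (m : ℕ) : chartOffset ξ c a τ m = pathSum (chart ξ c a) (c m) (a m) τ := by
  induction τ with
  | nil => rfl
  | cons s τ ih => simp only [chartOffset, pathSum, ih, chart]

theorem chartOffset_cons_apply (ξ : ℕ → E →ᵃ[ℝ] ℝ) (c : ℕ → ℝ) (a : ℕ → List Bool → ℝ)
    (s : Bool) (τ : List Bool) (m : ℕ) (p : E) :
    chartOffset ξ c a (s :: τ) m p = chartOffset ξ c a τ m p + a m τ * chart ξ c a τ p := rfl

theorem chartOffset_cons_linear (ξ : ℕ → E →ᵃ[ℝ] ℝ) (c : ℕ → ℝ) (a : ℕ → List Bool → ℝ)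
    (s : Bool) (τ : List Bool) (m : ℕ) (w : V) :
    (chartOffset ξ c a (s :: τ) m).linear w =
      (chartOffset ξ c a τ m).linear w + a m τ * (chart ξ c a τ).linear w := rfl

theorem chart_apply (ξ : ℕ → E →ᵃ[ℝ] ℝ) (c : ℕ → ℝ) (a : ℕ → List Bool → ℝ)
    (τ : List Bool) (p : E) :
    chart ξ c a τ p = ξ τ.length p - chartOffset ξ c a τ τ.length p := rfl

theorem chart_linear (ξ : ℕ → E →ᵃ[ℝ] ℝ) (c : ℕ → ℝ) (a : ℕ → List Bool → ℝ)
    (τ : List Bool) (w : V) :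
    (chart ξ c a τ).linear w =
      (ξ τ.length).linear w - (chartOffset ξ c a τ τ.length).linear w := rfl

theorem chartOffset_congr (ξ : ℕ → E →ᵃ[ℝ] ℝ) {c c' : ℕ → ℝ} {a a' : ℕ → List Bool → ℝ}
    {m : ℕ} (hc : ∀ j < m, c j = c' j) (ha : ∀ j < m, a j = a' j) {τ : List Bool}
    (hτ : τ.length ≤ m) {k : ℕ} (hck : c k = c' k) (hak : a k = a' k) :
    chartOffset ξ c a τ k = chartOffset ξ c' a' τ k := by
  induction τ generalizing k with
  | nil => simp only [chartOffset, hck]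
  | cons s τ ih =>
    have h : τ.length < m := hτ
    simp only [chartOffset, hak, ih h.le hck hak, ih h.le (hc _ h) (ha _ h)]

theorem chart_congr (ξ : ℕ → E →ᵃ[ℝ] ℝ) {c c' : ℕ → ℝ} {a a' : ℕ → List Bool → ℝ}
    {m : ℕ} (hc : ∀ j < m, c j = c' j) (ha : ∀ j < m, a j = a' j) {τ : List Bool}
    (hτ : τ.length < m) : chart ξ c a τ = chart ξ c' a' τ := by
  unfold chart
  rw [chartOffset_congr ξ hc ha hτ.le (hc _ hτ) (ha _ hτ)]

theorem chartOffset_linear_eq_zero (ξ : ℕ → E →ᵃ[ℝ] ℝ) (c : ℕ → ℝ) (a : ℕ → List Bool → ℝ)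
    {τ : List Bool} {w : V} (hw : ∀ i < τ.length, (ξ i).linear w = 0) (m : ℕ) :
    (chartOffset ξ c a τ m).linear w = 0 := by
  induction τ generalizing m with
  | nil => rfl
  | cons s τ ih =>
    have ih' := ih fun i hi => hw i (hi.trans (by simp))
    rw [chartOffset_cons_linear, chart_linear, ih', ih', hw τ.length (by simp)]
    simp

theorem chart_linear_eq (ξ : ℕ → E →ᵃ[ℝ] ℝ) (c : ℕ → ℝ) (a : ℕ → List Bool → ℝ)
    {τ : List Bool} {w : V} (hw : ∀ i < τ.length, (ξ i).linear w = 0) :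
    (chart ξ c a τ).linear w = (ξ τ.length).linear w := by
  rw [chart_linear, chartOffset_linear_eq_zero ξ c a hw, sub_zero]

theorem chartOffset_apply_eq (ξ : ℕ → E →ᵃ[ℝ] ℝ) (c : ℕ → ℝ) (a : ℕ → List Bool → ℝ)
    {τ : List Bool} {p : E} (hp : ∀ i < τ.length, ξ i p = c i) (m : ℕ) :
    chartOffset ξ c a τ m p = c m := by
  induction τ generalizing m with
  | nil => rfl
  | cons s τ ih =>
    have ih' := ih fun i hi => hp i (hi.trans (by simp))
    rw [chartOffset_cons_apply, chart_apply, ih', ih', hp τ.length (by simp)]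
    simp

theorem chart_apply_eq (ξ : ℕ → E →ᵃ[ℝ] ℝ) (c : ℕ → ℝ) (a : ℕ → List Bool → ℝ)
    {τ : List Bool} {p : E} (hp : ∀ i < τ.length, ξ i p = c i) :
    chart ξ c a τ p = ξ τ.length p - c τ.length := by
  rw [chart_apply, chartOffset_apply_eq ξ c a hp]

end Charts

section Equipartition

variable {V E : Type*} [AddCommGroup V] [Module ℝ V] [FiniteDimensional ℝ V] [AddTorsor V E]

theorem isHyperplaneOf_zero_locus {g : E →ᵃ[ℝ] ℝ} (hg : g.linear ≠ 0) {p : E} (hp : g p = 0) :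
    ∃ F : AffineSubspace ℝ E, IsHyperplaneOf F ⊤ ∧ (F : Set E) = {q | g q = 0} := by
  refine ⟨AffineSubspace.mk' p (LinearMap.ker g.linear),
    ⟨⟨p, AffineSubspace.self_mem_mk' p _⟩, le_top, ?_⟩, ?_⟩
  · rw [AffineSubspace.direction_mk', AffineSubspace.direction_top, finrank_top]
    have h1 := g.linear.finrank_range_add_finrank_ker
    rw [LinearMap.range_eq_top.2 (LinearMap.surjective hg), finrank_top,
      Module.finrank_self] at h1
    omega
  · ext q
    have h1 := g.linearMap_vsub q p
    rw [hp] at h1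
    simp [AffineSubspace.mem_mk', h1]

theorem ae_ne_zero_of_linear_ne_zero [MeasurableSpace E] {μ : Measure E}
    (hμ : ∀ F : AffineSubspace ℝ E, IsHyperplaneOf F ⊤ → μ (F : Set E) = 0)
    {g : E →ᵃ[ℝ] ℝ} (hg : g.linear ≠ 0) : ∀ᵐ p ∂μ, g p ≠ 0 := by
  rw [ae_iff]
  simp only [not_not]
  by_cases h : ∃ p, g p = 0
  · obtain ⟨p, hp⟩ := h
    obtain ⟨F, hF, hF'⟩ := isHyperplaneOf_zero_locus hg hp
    rw [← hF']
    exact hμ F hF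
  · push Not at h
    simp [h]

theorem continuous_affineMap [TopologicalSpace V] [IsTopologicalAddGroup V]
    [ContinuousSMul ℝ V] [T2Space V] [TopologicalSpace E] [IsTopologicalAddTorsor E]
    (g : E →ᵃ[ℝ] ℝ) : Continuous g := by
  obtain ⟨o⟩ : Nonempty E := inferInstance
  have h : ⇑g = fun p => g.linear (p -ᵥ o) + g o := by
    ext p
    rw [g.linearMap_vsub, vsub_eq_sub, sub_add_cancel]
  rw [h]
  exact (g.linear.continuous_of_finiteDimensional.comp
    (continuous_id.vsub continuous_const)).add continuous_const

variable [TopologicalSpace V] [IsTopologicalAddGroup V]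
  [ContinuousSMul ℝ V] [T2Space V] [TopologicalSpace E] [IsTopologicalAddTorsor E]
  [MeasurableSpace E] [BorelSpace E]

/-- A measure that vanishes on hyperplanes is cut into pieces of equal mass by the cells of a
suitable triangular system of charts. The coefficients at depth `m` are obtained by bisecting all
the cells of depth `m` simultaneously. -/
theorem exists_equipartition_cells {μ : Measure E} [IsFiniteMeasure μ]
    (hμ : ∀ F : AffineSubspace ℝ E, IsHyperplaneOf F ⊤ → μ (F : Set E) = 0)
    {n : ℕ} {ξ : ℕ → E →ᵃ[ℝ] ℝ} {e : ℕ → V} (hξ : IsCoordinateSystem n ξ e)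
    {m : ℕ} (hm : m ≤ n) :
    ∃ c a, ∀ σ : List Bool, σ.length = m →
      μ (cell (chart ξ c a) σ) = ((2 : ℝ≥0∞) ^ m)⁻¹ * μ Set.univ := by
  by_cases h0 : μ Set.univ = 0
  · exact ⟨0, 0, fun σ _ => by rw [h0, mul_zero]; exact measure_mono_null (Set.subset_univ _) h0⟩
  induction m with
  | zero =>
    refine ⟨0, 0, fun σ hσ => ?_⟩
    rw [List.length_eq_zero_iff.1 hσ]
    simp [cell]
  | succ m ih =>
    obtain ⟨c, a, hca⟩ := ih (by omega)
    have hmeas : ∀ g : E →ᵃ[ℝ] ℝ, Measurable g := fun g => (continuous_affineMap g).measurable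
    have he : ∀ j < n, ∀ i < j, (ξ i).linear (e j) = 0 := fun j hj i hi => by
      rw [hξ.dual i (hi.trans hj) j hj, if_neg hi.ne]
    have hnull : ∀ τ : List Bool, τ.length < m → ∀ᵐ p ∂μ, chart ξ c a τ p ≠ 0 := by
      intro τ hτ
      refine ae_ne_zero_of_linear_ne_zero hμ fun h => ?_
      have h1 := chart_linear_eq ξ c a (he τ.length (by omega))
      rw [h, hξ.dual _ (by omega) _ (by omega)] at h1
      simp at h1
    have hne : ∀ σ : List Bool, σ.length = m → ∀ c' a',
        ∀ᵐ p ∂μ, ξ m p ≠ pathSum (chart ξ c a) c' a' σ p := by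
      intro σ hσ c' a'
      -- the path sum is itself an offset, for coefficients changed at depth `m` only
      have hoff : pathSum (chart ξ c a) c' a' σ =
          chartOffset ξ (Function.update c m c') (Function.update a m a') σ m := by
        rw [chartOffset_eq_pathSum, Function.update_self, Function.update_self]
        refine pathSum_congr _ _ fun τ hτ => chart_congr (m := m) ξ ?_ ?_ (by omega)
        · exact fun j hj => by rw [Function.update_of_ne hj.ne]
        · exact fun j hj => by rw [Function.update_of_ne hj.ne]
      have h1 := ae_ne_zero_of_linear_ne_zero hμ
        (g := chart ξ (Function.update c m c') (Function.update a m a') σ) fun h => by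
          have h1 := chart_linear_eq ξ (Function.update c m c') (Function.update a m a')
            (τ := σ) (he σ.length (by omega))
          rw [h, hξ.dual _ (by omega) _ (by omega)] at h1
          simp at h1
      filter_upwards [h1] with p hp hp'
      refine hp ?_
      rw [chart_apply, hσ, ← hoff, hp', sub_self]
    obtain ⟨c', a', hbis⟩ := exists_pathSum_bisecting hmeas
      (fun σ hσ => by
        rw [hca σ hσ]
        exact mul_ne_zero (ENNReal.inv_ne_zero.2 (by finiteness)) h0) hnull hne
    refine ⟨Function.update c m c', Function.update a m a', fun σ' hσ' => ?_⟩
    obtain ⟨s, σ, rfl⟩ : ∃ s σ, σ' = s :: σ := List.exists_cons_of_length_eq_add_one hσ'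
    have hσ : σ.length = m := by simpa using hσ'
    have hchart : ∀ τ : List Bool, τ.length < m →
        chart ξ (Function.update c m c') (Function.update a m a') τ = chart ξ c a τ := fun τ hτ =>
      chart_congr (m := m) ξ (fun j hj => by rw [Function.update_of_ne hj.ne])
        (fun j hj => by rw [Function.update_of_ne hj.ne]) hτ
    have hval : ∀ p, chart ξ (Function.update c m c') (Function.update a m a') σ p =
        ξ m p - pathSum (chart ξ c a) c' a' σ p := by
      intro p
      rw [chart_apply, chartOffset_eq_pathSum, hσ, Function.update_self, Function.update_self,
        pathSum_congr c' a' fun τ hτ => hchart τ (by omega)]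
    have hcell : cell (chart ξ (Function.update c m c') (Function.update a m a')) (s :: σ) =
        cell (chart ξ c a) σ ∩ {p | 0 ≤ sgn s * (ξ m p - pathSum (chart ξ c a) c' a' σ p)} := by
      simp only [cell, hval]
      rw [cell_congr fun τ hτ => hchart τ (by omega)]
    set C := cell (chart ξ c a) σ
    set h := pathSum (chart ξ c a) c' a' σ
    have hhalf := hbis σ hσ
    have hae : ∀ᵐ p ∂μ, ξ m p ≠ h p := hne σ hσ c' a'
    have hsplit : μ C = μ (C ∩ {p | h p < ξ m p}) + μ (C ∩ {p | ξ m p < h p}) := by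
      rw [← measure_inter_add_sdiff C (measurableSet_lt (hmeas h) (hmeas (ξ m)))]
      congr 1
      refine measure_congr ?_
      filter_upwards [hae] with p hp
      exact propext ⟨fun hq => ⟨hq.1, lt_of_le_of_ne (not_lt.1 hq.2) hp⟩, fun hq =>
        ⟨hq.1, fun hq' : h p < ξ m p =>
        lt_asymm (show ξ m p < h p from hq.2) hq'⟩⟩
    have hpiece : μ (C ∩ {p | 0 ≤ sgn s * (ξ m p - h p)}) = μ (C ∩ {p | h p < ξ m p}) := by
      cases s
      · rw [hhalf]
        refine measure_congr ?_
        filter_upwards [hae] with p hp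
        refine propext (and_congr_right fun _ => ?_)
        change 0 ≤ sgn false * (ξ m p - h p) ↔ ξ m p < h p
        rw [hp.le_iff_lt.symm]
        simp [sgn]
      · refine measure_congr ?_
        filter_upwards [hae] with p hp
        refine propext (and_congr_right fun _ => ?_)
        change 0 ≤ sgn true * (ξ m p - h p) ↔ h p < ξ m p
        rw [hp.symm.le_iff_lt.symm]
        simp [sgn]
    rw [hcell, hpiece]
    rw [← hhalf, ← two_mul, hca σ hσ] at hsplit
    rw [pow_succ, ENNReal.mul_inv (Or.inr (by finiteness)) (Or.inr (by simp)),
      mul_comm _ (2 : ℝ≥0∞)⁻¹, mul_assoc, hsplit, ← mul_assoc,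
      ENNReal.inv_mul_cancel (by simp) (by finiteness), one_mul]

end Equipartition

/-! ### The cells form a Yao-Yao partition -/

section Geometry

variable {V E : Type*} [AddCommGroup V] [Module ℝ V] [AddTorsor V E]
  {n : ℕ} {ξ : ℕ → E →ᵃ[ℝ] ℝ} {e : ℕ → V}

theorem IsCoordinateSystem.linear_sum (hξ : IsCoordinateSystem n ξ e) (r : ℕ → ℝ) {i : ℕ}
    (hi : i < n) : (ξ i).linear (∑ j ∈ Finset.range n, r j • e j) = r i := by
  rw [map_sum, Finset.sum_eq_single_of_mem i (Finset.mem_range.2 hi)]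
  · rw [map_smul, hξ.dual i hi i hi, if_pos rfl, smul_eq_mul, mul_one]
  · intro j hj hji
    rw [map_smul, hξ.dual i hi j (Finset.mem_range.1 hj), if_neg hji.symm, smul_zero]

theorem IsCoordinateSystem.exists_point (hξ : IsCoordinateSystem n ξ e) (c : ℕ → ℝ) :
    ∃ x, ∀ i < n, ξ i x = c i := by
  obtain ⟨o⟩ : Nonempty E := inferInstance
  refine ⟨(∑ j ∈ Finset.range n, (c j - ξ j o) • e j) +ᵥ o, fun i hi => ?_⟩
  rw [AffineMap.map_vadd, hξ.linear_sum (fun j => c j - ξ j o) hi, vadd_eq_add, sub_add_cancel]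

/-- The vectors whose first `k` coordinates vanish. -/
def tailSpace (ξ : ℕ → E →ᵃ[ℝ] ℝ) (k : ℕ) : Submodule ℝ V where
  carrier := {w | ∀ i < k, (ξ i).linear w = 0}
  add_mem' hv hw i hi := by rw [map_add, hv i hi, hw i hi, add_zero]
  zero_mem' i _ := map_zero _
  smul_mem' r w hw i hi := by rw [map_smul, hw i hi, smul_zero]

theorem mem_tailSpace {k : ℕ} {w : V} : w ∈ tailSpace ξ k ↔ ∀ i < k, (ξ i).linear w = 0 :=
  Iff.rfl

theorem IsCoordinateSystem.finrank_tailSpace [FiniteDimensional ℝ V]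
    (hξ : IsCoordinateSystem n ξ e) {k : ℕ} (hk : k ≤ n) :
    Module.finrank ℝ (tailSpace ξ k) + k = n := by
  let L : V →ₗ[ℝ] (Fin k → ℝ) := LinearMap.pi fun i => (ξ i).linear
  have hker : LinearMap.ker L = tailSpace ξ k := by
    ext w
    rw [LinearMap.mem_ker, mem_tailSpace]
    exact ⟨fun h i hi => congrFun h ⟨i, hi⟩, fun h => funext fun i => h i i.2⟩
  have hsurj : LinearMap.range L = ⊤ := by
    rw [LinearMap.range_eq_top]
    intro r
    refine ⟨∑ j ∈ Finset.range n, (if h : j < k then r ⟨j, h⟩ else 0) • e j, funext fun i => ?_⟩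
    have := hξ.linear_sum (fun j => if h : j < k then r ⟨j, h⟩ else 0) (i.2.trans_le hk)
    refine Eq.trans (b := (ξ i).linear _) rfl (this.trans ?_)
    simp
  have h1 := L.finrank_range_add_finrank_ker
  rw [hker, hsurj, finrank_top, Module.finrank_fin_fun, hξ.finrank_eq] at h1
  omega

/-- The vector spanning the axis at the node `τ`: its coordinate of index `|τ|` is one, the
earlier ones vanish, and the later ones are the coefficients of the charts at `τ`. -/
noncomputable def axis (n : ℕ) (e : ℕ → V) (a : ℕ → List Bool → ℝ) (τ : List Bool) : V :=
  ∑ j ∈ Finset.range n, (if j < τ.length then 0 else if j = τ.length then 1 else a j τ) • e j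

theorem IsCoordinateSystem.linear_axis (hξ : IsCoordinateSystem n ξ e) (a : ℕ → List Bool → ℝ)
    (τ : List Bool) {i : ℕ} (hi : i < n) :
    (ξ i).linear (axis n e a τ) =
      if i < τ.length then 0 else if i = τ.length then 1 else a i τ :=
  hξ.linear_sum (fun j => if j < τ.length then 0 else if j = τ.length then 1 else a j τ) hi

theorem IsCoordinateSystem.axis_mem_tailSpace (hξ : IsCoordinateSystem n ξ e)
    (a : ℕ → List Bool → ℝ) {τ : List Bool} (hτ : τ.length ≤ n) :
    axis n e a τ ∈ tailSpace ξ τ.length := fun i hi => by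
  rw [hξ.linear_axis a τ (hi.trans_le hτ), if_pos hi]

theorem IsCoordinateSystem.chart_linear_axis_self (hξ : IsCoordinateSystem n ξ e)
    (c : ℕ → ℝ) (a : ℕ → List Bool → ℝ) {τ : List Bool} (hτ : τ.length < n) :
    (chart ξ c a τ).linear (axis n e a τ) = 1 := by
  rw [chart_linear_eq ξ c a (hξ.axis_mem_tailSpace a hτ.le), hξ.linear_axis a τ hτ]
  simp

theorem IsCoordinateSystem.chartOffset_linear_axis (hξ : IsCoordinateSystem n ξ e)
    (c : ℕ → ℝ) (a : ℕ → List Bool → ℝ) {s : Bool} {τ ρ : List Bool} (h : (s :: τ) <:+ ρ)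
    (hρ : ρ.length ≤ n) (m : ℕ) :
    (chartOffset ξ c a ρ m).linear (axis n e a τ) = a m τ := by
  induction ρ generalizing m with
  | nil => simp at h
  | cons t ρ ih =>
    have hρ' : ρ.length < n := hρ
    rw [chartOffset_cons_linear]
    rcases List.suffix_cons_iff.1 h with heq | h
    · obtain ⟨rfl, rfl⟩ := List.cons.inj heq
      rw [hξ.chart_linear_axis_self c a hρ',
        chartOffset_linear_eq_zero ξ c a (hξ.axis_mem_tailSpace a hρ'.le)]
      simp
    · have hlt : τ.length < ρ.length := h.length_le
      rw [chart_linear, ih h hρ'.le, ih h hρ'.le, hξ.linear_axis a τ hρ', if_neg hlt.not_gt,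
        if_neg hlt.ne']
      simp

/-- Along a branch of the tree, the linear parts of the charts are dual to the axes. -/
theorem IsCoordinateSystem.chart_linear_axis (hξ : IsCoordinateSystem n ξ e)
    (c : ℕ → ℝ) (a : ℕ → List Bool → ℝ) {s t : Bool} {τ ρ σ : List Bool}
    (hτ : (s :: τ) <:+ σ) (hρ : (t :: ρ) <:+ σ) (hσ : σ.length ≤ n) :
    (chart ξ c a ρ).linear (axis n e a τ) = if ρ = τ then 1 else 0 := by
  have hτn : τ.length < n := (hτ.length_le.trans hσ :)
  have hρn : ρ.length < n := (hρ.length_le.trans hσ :)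
  rcases lt_trichotomy ρ.length τ.length with hlt | heq | hgt
  · rw [if_neg (by rintro rfl; exact lt_irrefl _ hlt)]
    have hax := hξ.axis_mem_tailSpace a hτn.le
    rw [chart_linear_eq ξ c a fun i hi => hax i (hi.trans hlt)]
    exact hax _ hlt
  · obtain rfl : ρ = τ := by
      have h := List.suffix_of_suffix_length_le hρ hτ (by simp [heq])
      exact (List.cons.inj (h.eq_of_length (by simp [heq]))).2
    rw [if_pos rfl, hξ.chart_linear_axis_self c a hτn]
  · have hsuf : (s :: τ) <:+ ρ :=
      List.suffix_of_suffix_length_le hτ ((List.suffix_cons t ρ).trans hρ) hgt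
    rw [if_neg (by rintro rfl; exact lt_irrefl _ hgt), chart_linear,
      hξ.chartOffset_linear_axis c a hsuf hρn.le, hξ.linear_axis a τ hρn, if_neg hgt.not_gt,
      if_neg hgt.ne', sub_self]

theorem sign_eq_of_suffix {s t : Bool} {τ σ : List Bool} (hs : (s :: τ) <:+ σ)
    (ht : (t :: τ) <:+ σ) : s = t :=
  (List.cons.inj ((List.suffix_of_suffix_length_le hs ht (by simp)).eq_of_length (by simp))).1

/-- The points whose first `k` coordinates are `c 0, …, c (k - 1)`. -/
def flat (ξ : ℕ → E →ᵃ[ℝ] ℝ) (c : ℕ → ℝ) (k : ℕ) : Set E := {p | ∀ i < k, ξ i p = c i}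

theorem coe_mk'_tailSpace {c : ℕ → ℝ} {x : E} {k : ℕ} (hx : ∀ i < k, ξ i x = c i) :
    (AffineSubspace.mk' x (tailSpace ξ k) : Set E) = flat ξ c k := by
  ext p
  rw [SetLike.mem_coe, AffineSubspace.mem_mk', mem_tailSpace]
  refine forall₂_congr fun i hi => ?_
  rw [AffineMap.linearMap_vsub, vsub_eq_sub, sub_eq_zero, hx i hi]

/-- Sweeping the trace of a cell on the flat below a node along the axis at the node, on the side
of the cell, gives the trace of the cell on the flat at the node. -/
theorem IsCoordinateSystem.sweep_cell (hξ : IsCoordinateSystem n ξ e)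
    (c : ℕ → ℝ) (a : ℕ → List Bool → ℝ) {s : Bool} {τ σ : List Bool}
    (hs : (s :: τ) <:+ σ) (hσ : σ.length ≤ n) :
    sweep (cell (chart ξ c a) σ ∩ flat ξ c (τ.length + 1)) (sgn s • axis n e a τ) =
      cell (chart ξ c a) σ ∩ flat ξ c τ.length := by
  have hτn : τ.length < n := (hs.length_le.trans hσ :)
  have hax := hξ.axis_mem_tailSpace a hτn.le
  ext p
  constructor
  · rintro ⟨b, ⟨hb, hbf⟩, t, ht, rfl⟩
    refine ⟨mem_cell_iff.2 fun u ρ hu => ?_, fun i hi => ?_⟩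
    · have h1 := cell_sign hu hb
      rw [AffineMap.map_vadd, map_smul, map_smul, hξ.chart_linear_axis c a hs hu hσ]
      split_ifs with h
      · subst h
        obtain rfl := sign_eq_of_suffix hs hu
        have h2 := sgn_mul_self s
        simp only [smul_eq_mul, vadd_eq_add]
        nlinarith
      · simpa using h1
    · rw [AffineMap.map_vadd, map_smul, map_smul, hax i hi, hbf i (by omega)]
      simp
  · rintro ⟨hp, hpf⟩
    set r := chart ξ c a τ p with hr
    have hpb : ∀ g : E →ᵃ[ℝ] ℝ, g (-(r • axis n e a τ) +ᵥ p) =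
        g p - r * g.linear (axis n e a τ) := fun g => by
      rw [AffineMap.map_vadd, map_neg, map_smul, vadd_eq_add, smul_eq_mul]
      ring
    refine ⟨-(r • axis n e a τ) +ᵥ p, ⟨mem_cell_iff.2 fun u ρ hu => ?_, fun i hi => ?_⟩,
      sgn s * r, cell_sign hs hp, ?_⟩
    · rw [hpb, hξ.chart_linear_axis c a hs hu hσ]
      split_ifs with h
      · subst h
        simp [hr]
      · simpa using cell_sign hu hp
    · rcases Nat.lt_succ_iff_lt_or_eq.1 hi with hlt | rfl
      · rw [hpb, hax i hlt, hpf i hlt]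
        simp
      · have h1 := chart_apply_eq ξ c a (τ := τ) (p := -(r • axis n e a τ) +ᵥ p) fun i hi => by
          rw [hpb, hax i hi, hpf i hi]
          simp
        rw [hpb, hξ.chart_linear_axis_self c a hτn, ← hr] at h1
        linarith
    · rw [vadd_vadd, smul_smul, mul_assoc, mul_comm r, ← mul_assoc, sgn_mul_self, one_mul,
        add_neg_cancel, zero_vadd]

/-- The family of sets obtained from the center `x` and a tree `v` of axes by sweeping `k` times,
starting from the nodes `k` levels below `τ`. -/
def sweptFamily (v : List Bool → V) (x : E) : ℕ → List Bool → Set (Set E)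
  | 0, _ => {{x}}
  | k + 1, τ => (fun A => sweep A (-v τ)) '' sweptFamily v x k (false :: τ) ∪
      (fun A => sweep A (v τ)) '' sweptFamily v x k (true :: τ)

theorem IsCoordinateSystem.isPartitionOf_sweptFamily [FiniteDimensional ℝ V]
    (hξ : IsCoordinateSystem n ξ e) (a : ℕ → List Bool → ℝ) (x : E) (k : ℕ) (τ : List Bool)
    (hk : τ.length + k = n) :
    IsPartitionOf (AffineSubspace.mk' x (tailSpace ξ τ.length))
      (sweptFamily (axis n e a) x k τ) x := by
  induction k generalizing τ with
  | zero =>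
    refine .point _ x ?_
    have h1 := hξ.finrank_tailSpace (k := τ.length) (by omega)
    have h2 : tailSpace ξ τ.length = ⊥ := Submodule.finrank_eq_zero.1 (by omega)
    ext p
    simp [h2, AffineSubspace.mem_mk', vsub_eq_zero_iff_eq]
  | succ k ih =>
    have h1 := hξ.finrank_tailSpace (k := τ.length) (by omega)
    have h2 := hξ.finrank_tailSpace (k := τ.length + 1) (by omega)
    have hle : tailSpace ξ (τ.length + 1) ≤ tailSpace ξ τ.length :=
      fun w hw i hi => hw i (by omega)
    refine .step _ (AffineSubspace.mk' x (tailSpace ξ (τ.length + 1))) (axis n e a τ)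
      (sweptFamily (axis n e a) x k (true :: τ)) (sweptFamily (axis n e a) x k (false :: τ)) x
      ⟨⟨x, AffineSubspace.self_mem_mk' x _⟩, fun p hp => ?_, ?_⟩ ?_ ?_
      (ih (true :: τ) (by simp; omega)) (ih (false :: τ) (by simp; omega))
    · rw [AffineSubspace.mem_mk'] at hp ⊢
      exact hle hp
    · rw [AffineSubspace.direction_mk', AffineSubspace.direction_mk']
      omega
    · rw [AffineSubspace.direction_mk']
      exact hξ.axis_mem_tailSpace a (by omega)
    · rw [AffineSubspace.direction_mk']
      intro h
      have h3 := h τ.length (by omega)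
      rw [hξ.linear_axis a τ (by omega)] at h3
      simp at h3

theorem IsCoordinateSystem.sweptFamily_eq (hξ : IsCoordinateSystem n ξ e)
    {c : ℕ → ℝ} (a : ℕ → List Bool → ℝ) {x : E} (hx : ∀ i < n, ξ i x = c i) (k : ℕ)
    (τ : List Bool) (hk : τ.length + k = n) (hinj : flat ξ c n = {x}) :
    sweptFamily (axis n e a) x k τ =
      (fun σ => cell (chart ξ c a) σ ∩ flat ξ c τ.length) '' {σ | σ.length = n ∧ τ <:+ σ} := by
  induction k generalizing τ with
  | zero =>
    have hτ : {σ : List Bool | σ.length = n ∧ τ <:+ σ} = {τ} := by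
      ext σ
      constructor
      · rintro ⟨h1, h2⟩
        exact (h2.eq_of_length (by omega)).symm
      · intro h
        rw [Set.mem_singleton_iff.1 h]
        exact ⟨(by omega : τ.length = n), List.suffix_rfl⟩
    have hxc : x ∈ cell (chart ξ c a) τ := mem_cell_iff.2 fun s ρ h => by
      have hρ : ρ.length < n := (h.length_le.trans (show τ.length ≤ n by omega) :)
      rw [chart_apply_eq ξ c a fun i hi => hx i (hi.trans hρ), hx _ hρ]
      simp
    have hτn : τ.length = n := by omega
    simp [sweptFamily, hτ, hτn, hinj, hxc]
  | succ k ih =>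
    have hset : {σ : List Bool | σ.length = n ∧ τ <:+ σ} =
        {σ | σ.length = n ∧ (false :: τ) <:+ σ} ∪ {σ | σ.length = n ∧ (true :: τ) <:+ σ} := by
      ext σ
      constructor
      · rintro ⟨h1, h2⟩
        obtain ⟨s, hs⟩ := exists_cons_suffix h2 (by omega)
        cases s
        · exact Or.inl ⟨h1, hs⟩
        · exact Or.inr ⟨h1, hs⟩
      · rintro (⟨h1, h2⟩ | ⟨h1, h2⟩)
        · exact ⟨h1, (List.suffix_cons _ _).trans h2⟩
        · exact ⟨h1, (List.suffix_cons _ _).trans h2⟩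
    simp only [sweptFamily]
    rw [ih (false :: τ) (by simp; omega), ih (true :: τ) (by simp; omega), hset, Set.image_union,
      Set.image_image, Set.image_image]
    congr 1
    · refine Set.image_congr fun σ hσ => ?_
      have := hξ.sweep_cell c a hσ.2 hσ.1.le
      simpa [sgn] using this
    · refine Set.image_congr fun σ hσ => ?_
      have := hξ.sweep_cell c a hσ.2 hσ.1.le
      simpa [sgn] using this

theorem IsCoordinateSystem.flat_eq_singleton [FiniteDimensional ℝ V]
    (hξ : IsCoordinateSystem n ξ e) {c : ℕ → ℝ} {x : E} (hx : ∀ i < n, ξ i x = c i) :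
    flat ξ c n = {x} := by
  have h1 := hξ.finrank_tailSpace le_rfl
  have h2 : tailSpace ξ n = ⊥ := Submodule.finrank_eq_zero.1 (by omega)
  rw [← coe_mk'_tailSpace hx]
  ext p
  simp [h2, AffineSubspace.mem_mk', vsub_eq_zero_iff_eq]

theorem IsCoordinateSystem.isYaoYaoPartition_cells [FiniteDimensional ℝ V]
    (hξ : IsCoordinateSystem n ξ e) {c : ℕ → ℝ} (a : ℕ → List Bool → ℝ) {x : E}
    (hx : ∀ i < n, ξ i x = c i) :
    IsYaoYaoPartition (cell (chart ξ c a) '' {σ | σ.length = n}) x := by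
  have h1 := hξ.isPartitionOf_sweptFamily a x n [] (by simp)
  rw [hξ.sweptFamily_eq a hx n [] (by simp) (hξ.flat_eq_singleton hx)] at h1
  have h2 : AffineSubspace.mk' x (tailSpace ξ ([] : List Bool).length) = ⊤ := by
    ext p
    simp [AffineSubspace.mem_mk', mem_tailSpace]
  rw [h2] at h1
  change IsPartitionOf ⊤ _ x
  simpa [flat] using h1

/-! ### Combinatorics and shape of the cells -/

theorem exists_mem_cell (Φ : List Bool → E →ᵃ[ℝ] ℝ) (m : ℕ) (p : E) :
    ∃ σ : List Bool, σ.length = m ∧ p ∈ cell Φ σ := by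
  induction m with
  | zero => exact ⟨[], rfl, trivial⟩
  | succ m ih =>
    obtain ⟨σ, hσ, hp⟩ := ih
    obtain ⟨s, hs⟩ := exists_sgn_mul_eq_abs (Φ σ p)
    exact ⟨s :: σ, by simp [hσ], hp, by simp [hs]⟩

theorem exists_branching {σ σ' : List Bool} (hlen : σ.length = σ'.length) (hne : σ ≠ σ') :
    ∃ s τ, (s :: τ) <:+ σ ∧ ((!s) :: τ) <:+ σ' := by
  induction σ generalizing σ' with
  | nil => exact absurd (List.length_eq_zero_iff.1 hlen.symm).symm hne
  | cons s τ ih =>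
    obtain ⟨s', τ', rfl⟩ := List.exists_cons_of_length_eq_add_one hlen.symm
    by_cases h : τ = τ'
    · subst h
      refine ⟨s, τ, List.suffix_rfl, ?_⟩
      obtain rfl : s' = !s := by
        cases s <;> cases s' <;> simp_all
      exact List.suffix_rfl
    · obtain ⟨t, ρ, h1, h2⟩ := ih (by simpa using hlen) h
      exact ⟨t, ρ, h1.trans (List.suffix_cons _ _), h2.trans (List.suffix_cons _ _)⟩

theorem cons_drop_suffix {σ : List Bool} {i : ℕ} (hi : i < σ.length) :
    (σ[i] :: σ.drop (i + 1)) <:+ σ := by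
  rw [← List.drop_eq_getElem_cons hi]
  exact List.drop_suffix i σ

theorem exists_eq_drop {σ : List Bool} {s : Bool} {τ : List Bool} (h : (s :: τ) <:+ σ) :
    ∃ (i : ℕ) (hi : i < σ.length), s = σ[i] ∧ τ = σ.drop (i + 1) := by
  have h1 := List.suffix_iff_eq_drop.1 h
  have h2 := h.length_le
  simp only [List.length_cons] at h1 h2
  have hi : σ.length - (τ.length + 1) < σ.length := by omega
  rw [List.drop_eq_getElem_cons hi] at h1
  exact ⟨_, hi, List.cons.inj h1⟩

/-- A cell of full depth is the cone at the center spanned by the signed axes along the branch. -/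
theorem IsCoordinateSystem.exists_basis_cell [FiniteDimensional ℝ V]
    (hξ : IsCoordinateSystem (Module.finrank ℝ V) ξ e) {c : ℕ → ℝ} (a : ℕ → List Bool → ℝ)
    {x : E} (hx : ∀ i < Module.finrank ℝ V, ξ i x = c i) {σ : List Bool}
    (hσ : σ.length = Module.finrank ℝ V) :
    ∃ b : Module.Basis (Fin (Module.finrank ℝ V)) ℝ V,
      ∀ (r : Fin (Module.finrank ℝ V) → ℝ) (i : Fin (Module.finrank ℝ V)),
        sgn (σ[i]'(by omega)) * chart ξ c a (σ.drop (i + 1)) ((∑ j, r j • b j) +ᵥ x) = r i := by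
  let u : Fin (Module.finrank ℝ V) → V := fun i =>
    sgn (σ[i]'(by omega)) • axis (Module.finrank ℝ V) e a (σ.drop (i + 1))
  have hval : ∀ (r : Fin (Module.finrank ℝ V) → ℝ) (i : Fin (Module.finrank ℝ V)),
      sgn (σ[i]'(by omega)) * (chart ξ c a (σ.drop (i + 1))).linear (∑ j, r j • u j) = r i := by
    intro r i
    rw [map_sum, Finset.sum_eq_single_of_mem i (Finset.mem_univ i)]
    · rw [map_smul, map_smul, hξ.chart_linear_axis c a (cons_drop_suffix (by omega))
        (cons_drop_suffix (by omega)) hσ.le, if_pos rfl]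
      simp only [smul_eq_mul, mul_one]
      linear_combination r i * sgn_mul_self (σ[i]'(by omega))
    · intro j _ hji
      rw [map_smul, map_smul, hξ.chart_linear_axis c a (cons_drop_suffix (by omega))
        (cons_drop_suffix (by omega)) hσ.le, if_neg, smul_zero, smul_zero]
      intro h
      have := congrArg List.length h
      simp only [List.length_drop] at this
      exact hji (Fin.ext (by omega))
  have hli : LinearIndependent ℝ u := by
    rw [Fintype.linearIndependent_iff]
    intro r hr i
    rw [← hval r i, hr, map_zero, mul_zero]
  have hcenter : ∀ i : Fin (Module.finrank ℝ V), chart ξ c a (σ.drop (i + 1)) x = 0 := by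
    intro i
    have hlt : (σ.drop (i + 1)).length < Module.finrank ℝ V := by
      rw [List.length_drop]
      omega
    rw [chart_apply_eq ξ c a fun j hj => hx j (hj.trans hlt), hx _ hlt, sub_self]
  refine ⟨basisOfLinearIndependentOfCardEqFinrank' u hli (by simp), fun r i => ?_⟩
  rw [AffineMap.map_vadd, hcenter]
  simpa using hval r i

theorem IsCoordinateSystem.isSimplicialCone_cell [FiniteDimensional ℝ V]
    (hξ : IsCoordinateSystem (Module.finrank ℝ V) ξ e) {c : ℕ → ℝ} (a : ℕ → List Bool → ℝ)
    {x : E} (hx : ∀ i < Module.finrank ℝ V, ξ i x = c i) {σ : List Bool}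
    (hσ : σ.length = Module.finrank ℝ V) :
    IsSimplicialCone x (cell (chart ξ c a) σ) := by
  obtain ⟨b, hb⟩ := hξ.exists_basis_cell a hx hσ
  refine ⟨b, Set.ext fun p => ⟨fun hp => ⟨b.repr (p -ᵥ x), fun i => ?_, ?_⟩, ?_⟩⟩
  · rw [← hb (b.repr (p -ᵥ x)) i, b.sum_repr, vsub_vadd]
    exact cell_sign (cons_drop_suffix (by omega)) hp
  · rw [b.sum_repr, vsub_vadd]
  · rintro ⟨r, hr, rfl⟩
    refine mem_cell_iff.2 fun s τ h => ?_
    obtain ⟨i, hi, rfl, rfl⟩ := exists_eq_drop h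
    exact (hr ⟨i, by omega⟩).trans_eq (hb r ⟨i, by omega⟩).symm

theorem IsCoordinateSystem.exists_pos_of_cell [FiniteDimensional ℝ V]
    (hξ : IsCoordinateSystem (Module.finrank ℝ V) ξ e) {c : ℕ → ℝ} (a : ℕ → List Bool → ℝ)
    {x : E} (hx : ∀ i < Module.finrank ℝ V, ξ i x = c i) {σ : List Bool}
    (hσ : σ.length = Module.finrank ℝ V) :
    ∃ p, ∀ s τ, (s :: τ) <:+ σ → 0 < sgn s * chart ξ c a τ p := by
  obtain ⟨b, hb⟩ := hξ.exists_basis_cell a hx hσ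
  refine ⟨(∑ j, (1 : ℝ) • b j) +ᵥ x, fun s τ h => ?_⟩
  obtain ⟨i, hi, rfl, rfl⟩ := exists_eq_drop h
  exact zero_lt_one.trans_eq (hb (fun _ => 1) ⟨i, by omega⟩).symm

theorem IsCoordinateSystem.cell_injOn [FiniteDimensional ℝ V]
    (hξ : IsCoordinateSystem (Module.finrank ℝ V) ξ e) {c : ℕ → ℝ} (a : ℕ → List Bool → ℝ)
    {x : E} (hx : ∀ i < Module.finrank ℝ V, ξ i x = c i) :
    Set.InjOn (cell (chart ξ c a)) {σ | σ.length = Module.finrank ℝ V} := by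
  intro σ hσ σ' hσ' heq
  by_contra hne
  obtain ⟨s, τ, h1, h2⟩ := exists_branching (Eq.trans hσ (Eq.symm hσ')) hne
  obtain ⟨p, hp⟩ := hξ.exists_pos_of_cell a hx hσ
  have hpc : p ∈ cell (chart ξ c a) σ := mem_cell_iff.2 fun t ρ h => (hp t ρ h).le
  rw [heq] at hpc
  have h3 := cell_sign h2 hpc
  have h4 := hp s τ h1
  rw [sgn_not] at h3
  linarith

theorem ncard_length_eq (n : ℕ) : {σ : List Bool | σ.length = n}.ncard = 2 ^ n := by
  rw [← Nat.card_coe_set_eq]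
  exact (Nat.card_eq_fintype_card (α := List.Vector Bool n)).trans (by simp)

theorem pos_of_mem_interior [TopologicalSpace V] [ContinuousSMul ℝ V] [TopologicalSpace E]
    [IsTopologicalAddTorsor E] {g : E →ᵃ[ℝ] ℝ} (hg : g.linear ≠ 0) {S : Set E}
    (hS : ∀ p ∈ S, 0 ≤ g p) {q : E} (hq : q ∈ interior S) : 0 < g q := by
  obtain ⟨w, hw⟩ : ∃ w, g.linear w = 1 := LinearMap.surjective hg 1
  have hcont : Tendsto (fun t : ℝ => (t • w) +ᵥ q) (𝓝[<] 0) (𝓝 q) := by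
    have h1 : Continuous fun t : ℝ => (t • w) +ᵥ q := by fun_prop
    have h2 := h1.tendsto 0
    simp only [zero_smul, zero_vadd] at h2
    exact h2.mono_left nhdsWithin_le_nhds
  obtain ⟨t, ht, ht0⟩ :=
    ((hcont.eventually (mem_interior_iff_mem_nhds.1 hq)).and self_mem_nhdsWithin).exists
  have h3 := hS _ ht
  rw [AffineMap.map_vadd, map_smul, hw, smul_eq_mul, mul_one, vadd_eq_add] at h3
  have h4 : t < 0 := ht0
  linarith

theorem IsCoordinateSystem.isPartition_cells
    [TopologicalSpace V] [ContinuousSMul ℝ V] [TopologicalSpace E]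
    [IsTopologicalAddTorsor E]
    (hξ : IsCoordinateSystem n ξ e) (c : ℕ → ℝ) (a : ℕ → List Bool → ℝ) :
    IsPartition (cell (chart ξ c a) '' {σ | σ.length = n}) := by
  refine ⟨Set.eq_univ_of_forall fun p => ?_, ?_⟩
  · obtain ⟨σ, hσ, hp⟩ := exists_mem_cell (chart ξ c a) n p
    exact ⟨_, ⟨σ, hσ, rfl⟩, hp⟩
  · rintro _ ⟨σ, hσ, rfl⟩ _ ⟨σ', hσ', rfl⟩ hne
    obtain ⟨s, τ, h1, h2⟩ := exists_branching (Eq.trans hσ (Eq.symm hσ'))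
      (fun h => hne (congrArg _ h))
    have hτ : τ.length < n := (h1.length_le.trans_eq hσ :)
    have hlin : ∀ t, (sgn t • chart ξ c a τ).linear ≠ 0 := fun t h => by
      have h3 := LinearMap.congr_fun h (axis n e a τ)
      rw [AffineMap.smul_linear, LinearMap.smul_apply, hξ.chart_linear_axis_self c a hτ] at h3
      cases t <;> simp [sgn] at h3
    rw [Set.disjoint_left]
    intro q hq hq'
    have h3 : 0 < sgn s * chart ξ c a τ q :=
      pos_of_mem_interior (hlin s) (fun p hp => cell_sign h1 hp) hq
    have h4 : 0 < sgn (!s) * chart ξ c a τ q :=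
      pos_of_mem_interior (hlin (!s)) (fun p hp => cell_sign h2 hp) hq'
    rw [sgn_not] at h4
    linarith

end Geometry

theorem exists_yaoYaoEquipartition {V E : Type*}
    [AddCommGroup V] [Module ℝ V] [FiniteDimensional ℝ V]
    [TopologicalSpace V] [IsTopologicalAddGroup V] [ContinuousSMul ℝ V] [T2Space V]
    [AddTorsor V E] [TopologicalSpace E] [IsTopologicalAddTorsor E]
    [MeasurableSpace E] [BorelSpace E]
    (μ : MeasureTheory.Measure E) [MeasureTheory.IsFiniteMeasure μ]
    (hμ : ∀ F : AffineSubspace ℝ E, IsHyperplaneOf F ⊤ → μ (F : Set E) = 0) :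
    ∃ (P : Set (Set E)) (x : E), IsYaoYaoEquipartition (V := V) μ P x ∧
      P.ncard = 2 ^ Module.finrank ℝ V ∧ IsPartition P ∧
      ∀ A ∈ P, IsSimplicialCone (V := V) x A := by
  obtain ⟨ξ, e, hξ⟩ := exists_isCoordinateSystem V E
  obtain ⟨c, a, hca⟩ := exists_equipartition_cells hμ hξ le_rfl
  obtain ⟨x, hx⟩ := hξ.exists_point c
  refine ⟨cell (chart ξ c a) '' {σ | σ.length = Module.finrank ℝ V}, x,
    ⟨hξ.isYaoYaoPartition_cells a hx, ?_⟩, ?_, hξ.isPartition_cells c a, ?_⟩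
  · rintro _ ⟨σ, hσ, rfl⟩
    exact hca σ hσ
  · rw [(hξ.cell_injOn a hx).ncard_image, ncard_length_eq]
  · rintro _ ⟨σ, hσ, rfl⟩
    exact hξ.isSimplicialCone_cell a hx hσ

/-! ### Measures with a center of symmetry -/

section Transfer

variable {V E V' E' : Type*} [AddCommGroup V] [Module ℝ V] [AddTorsor V E]
  [AddCommGroup V'] [Module ℝ V'] [AddTorsor V' E']

theorem image_sweep (f : E →ᵃ[ℝ] E') (A : Set E) (v : V) :
    f '' sweep A v = sweep (f '' A) (f.linear v) := by
  ext p
  constructor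
  · rintro ⟨_, ⟨a, ha, t, ht, rfl⟩, rfl⟩
    exact ⟨f a, ⟨a, ha, rfl⟩, t, ht, by rw [AffineMap.map_vadd, map_smul]⟩
  · rintro ⟨_, ⟨a, ha, rfl⟩, t, ht, rfl⟩
    exact ⟨t • v +ᵥ a, ⟨a, ha, t, ht, rfl⟩, by rw [AffineMap.map_vadd, map_smul]⟩

/-- Injective affine maps carry Yao-Yao partitions to Yao-Yao partitions. -/
theorem IsPartitionOf.map {G : AffineSubspace ℝ E} {P : Set (Set E)} {x : E}
    (h : IsPartitionOf G P x) {f : E →ᵃ[ℝ] E'} (hf : Function.Injective f) :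
    IsPartitionOf (G.map f) ((fun A => f '' A) '' P) (f x) := by
  have hlin : Function.Injective f.linear := f.linear_injective_iff.2 hf
  have hrank : ∀ W : Submodule ℝ V, Module.finrank ℝ (W.map f.linear) = Module.finrank ℝ W :=
    fun W => (Submodule.equivMapOfInjective f.linear hlin W).finrank_eq.symm
  induction h with
  | point G x hG =>
    have := IsPartitionOf.point (G.map f) (f x) (by
      rw [AffineSubspace.coe_map, hG, Set.image_singleton])
    simpa using this
  | step G F v Ppos Pneg x hF hvG hvF _ _ ihpos ihneg =>
    have := IsPartitionOf.step (G.map f) (F.map f) (f.linear v) _ _ (f x) ?_ ?_ ?_ ihpos ihneg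
    · rw [Set.image_union]
      simp only [Set.image_image, image_sweep, map_neg] at this ⊢
      exact this
    · refine ⟨?_, AffineSubspace.map_mono f hF.2.1, ?_⟩
      · rw [AffineSubspace.coe_map]
        exact hF.1.image f
      · rw [AffineSubspace.map_direction, AffineSubspace.map_direction, hrank, hrank]
        exact hF.2.2
    · rw [AffineSubspace.map_direction]
      exact Submodule.mem_map_of_mem hvG
    · rw [AffineSubspace.map_direction]
      rintro ⟨w, hw, hwv⟩
      exact hvF (hlin hwv ▸ hw)

theorem IsSimplicialCone.smul_vsub_vadd_mem {x : E} {A : Set E}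
    (h : IsSimplicialCone (V := V) x A) {p : E} (hp : p ∈ A) {t : ℝ} (ht : 0 ≤ t) :
    t • (p -ᵥ x) +ᵥ x ∈ A := by
  obtain ⟨b, rfl⟩ := h
  obtain ⟨c, hc, rfl⟩ := hp
  refine ⟨fun i => t * c i, fun i => mul_nonneg ht (hc i), ?_⟩
  rw [vadd_vsub, Finset.smul_sum]
  simp only [smul_smul]

theorem IsSimplicialCone.measurableSet [FiniteDimensional ℝ V]
    [TopologicalSpace V] [IsTopologicalAddGroup V] [ContinuousSMul ℝ V] [T2Space V]
    [TopologicalSpace E] [IsTopologicalAddTorsor E] [MeasurableSpace E] [BorelSpace E]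
    {x : E} {A : Set E} (h : IsSimplicialCone (V := V) x A) : MeasurableSet A := by
  obtain ⟨b, rfl⟩ := h
  have h1 : {p : E | ∃ c : Fin (Module.finrank ℝ V) → ℝ,
      (∀ i, 0 ≤ c i) ∧ p = (∑ i, c i • b i) +ᵥ x} = ⋂ i, {p | 0 ≤ b.coord i (p -ᵥ x)} := by
    ext p
    rw [Set.mem_iInter]
    constructor
    · rintro ⟨c, hc, rfl⟩ i
      simpa [Finsupp.single_apply] using hc i
    · intro hp
      refine ⟨b.repr (p -ᵥ x), hp, ?_⟩
      rw [b.sum_repr, vsub_vadd]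
  rw [h1]
  refine MeasurableSet.iInter fun i => (isClosed_le continuous_const ?_).measurableSet
  exact (b.coord i).continuous_of_finiteDimensional.comp (continuous_id.vsub continuous_const)

end Transfer

section Symmetric

variable {V E : Type*} [AddCommGroup V] [Module ℝ V] [AddTorsor V E]

/-- The projection onto the kernel of the linear functional `l` along a vector `e` with
`l e = 1`. -/
def kerProj (l : V →ₗ[ℝ] ℝ) (e : V) (he : l e = 1) : V →ₗ[ℝ] LinearMap.ker l :=
  LinearMap.codRestrict _ (LinearMap.id - l.smulRight e) fun u => by
    simp [he]

theorem coe_kerProj (l : V →ₗ[ℝ] ℝ) (e : V) (he : l e = 1) (u : V) :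
    (kerProj l e he u : V) = u - l u • e := rfl

/-- The central projection from `x` onto the hyperplane through `e +ᵥ x` parallel to `ker l`,
identified with `ker l`. -/
noncomputable def centralProj (l : V →ₗ[ℝ] ℝ) (e : V) (he : l e = 1) (x p : E) :
    LinearMap.ker l :=
  (l (p -ᵥ x))⁻¹ • kerProj l e he (p -ᵥ x)

/-- If `A` is a cone with apex `w`, then sweeping `A - w`, placed at `x`, along `e + w` gives a
set which coincides on the open half-space `0 < l (· - x)` with the inverse image of `A` under the
central projection. -/
theorem mem_sweep_iff_centralProj_mem {l : V →ₗ[ℝ] ℝ} {e : V} (he : l e = 1) {x p : E}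
    {w : LinearMap.ker l} {A : Set (LinearMap.ker l)}
    (hA : ∀ a ∈ A, ∀ t : ℝ, 0 ≤ t → t • (a - w) + w ∈ A) (hp : 0 < l (p -ᵥ x)) :
    p ∈ sweep ((fun a : LinearMap.ker l => ((a - w : LinearMap.ker l) : V) +ᵥ x) '' A) (e + w) ↔
      centralProj l e he x p ∈ A := by
  have hw : l w = 0 := w.2
  constructor
  · rintro ⟨_, ⟨a, ha, rfl⟩, t, ht, rfl⟩
    have ha0 : l a = 0 := a.2
    rw [vadd_vadd, vadd_vsub] at hp
    have hl : l (t • (e + (w : V)) + ((a - w : LinearMap.ker l) : V)) = t := by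
      simp [he, hw, ha0]
    rw [hl] at hp
    have hproj : centralProj l e he x (t • (e + (w : V)) +ᵥ
        (((a - w : LinearMap.ker l) : V) +ᵥ x)) = t⁻¹ • (a - w) + w := by
      unfold centralProj
      rw [vadd_vadd, vadd_vsub, hl, eq_comm, eq_inv_smul_iff₀ hp.ne']
      ext
      rw [coe_kerProj, hl]
      simp only [smul_add, Submodule.coe_add, Submodule.coe_smul, smul_inv_smul₀ hp.ne']
      abel
    beta_reduce
    rw [hproj]
    exact hA a ha _ (inv_nonneg.2 hp.le)
  · intro h
    set t := l (p -ᵥ x) with ht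
    refine ⟨_, ⟨_, hA _ h t hp.le, rfl⟩, t, hp.le, ?_⟩
    have h1 : t • centralProj l e he x p = kerProj l e he (p -ᵥ x) := by
      unfold centralProj
      rw [← ht, smul_inv_smul₀ hp.ne']
    beta_reduce
    rw [add_sub_cancel_right, smul_sub, h1, vadd_vadd, eq_vadd_iff_vsub_eq, Submodule.coe_sub,
      coe_kerProj, Submodule.coe_smul, ← ht, smul_add]
    abel

theorem measure_preimage_pointReflection [TopologicalSpace V] [TopologicalSpace E]
    [IsTopologicalAddTorsor E] [MeasurableSpace E] [BorelSpace E] {μ : Measure E} {x : E}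
    (hx : IsCenterOfSymmetry (V := V) μ x) (S : Set E) :
    μ (AffineEquiv.pointReflection ℝ (V₁ := V) x ⁻¹' S) = μ S := by
  have hcont : Continuous (AffineEquiv.pointReflection ℝ (V₁ := V) x) := by
    have h : ⇑(AffineEquiv.pointReflection ℝ (V₁ := V) x) = fun p => (x -ᵥ p) +ᵥ x := by
      ext p
      exact AffineEquiv.pointReflection_apply ℝ x p
    rw [h]
    exact (continuous_const.vsub continuous_id).vadd continuous_const
  let r : E ≃ᵐ E :=
    { toEquiv := (AffineEquiv.pointReflection ℝ (V₁ := V) x).toEquiv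
      measurable_toFun := hcont.measurable
      measurable_invFun := by
        change Measurable (AffineEquiv.pointReflection ℝ (V₁ := V) x).symm
        rw [AffineEquiv.pointReflection_symm]
        exact hcont.measurable }
  exact (r.map_apply (μ := μ) S).symm.trans <| congrArg (fun ν : Measure E => ν S) hx

variable [FiniteDimensional ℝ V]
  [TopologicalSpace V] [IsTopologicalAddGroup V] [ContinuousSMul ℝ V] [T2Space V]
  [TopologicalSpace E] [IsTopologicalAddTorsor E] [MeasurableSpace E] [BorelSpace E]

theorem aemeasurable_centralProj (μ : Measure E) {l : V →ₗ[ℝ] ℝ} {e : V} (he : l e = 1) (x : E)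
    [MeasurableSpace (LinearMap.ker l)] [BorelSpace (LinearMap.ker l)] :
    AEMeasurable (centralProj l e he x) (μ.restrict {p | 0 < l (p -ᵥ x)}) := by
  have hcont : Continuous fun p : E => l (p -ᵥ x) :=
    l.continuous_of_finiteDimensional.comp (continuous_id.vsub continuous_const)
  refine ContinuousOn.aemeasurable ?_ (isOpen_lt continuous_const hcont).measurableSet
  refine ContinuousOn.smul (hcont.continuousOn.inv₀ fun p hp => ne_of_gt hp) ?_
  exact ((kerProj l e he).continuous_of_finiteDimensional.comp
    (continuous_id.vsub continuous_const)).continuousOn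

/-- The central projection of a measure on an open half-space bounded by a hyperplane through `x`
vanishes on hyperplanes, since these are the central projections of hyperplanes through `x`. -/
theorem map_centralProj_hyperplane {μ : Measure E}
    (hμ : ∀ F : AffineSubspace ℝ E, IsHyperplaneOf F ⊤ → μ (F : Set E) = 0)
    {l : V →ₗ[ℝ] ℝ} {e : V} (he : l e = 1) (x : E)
    [MeasurableSpace (LinearMap.ker l)] [BorelSpace (LinearMap.ker l)]
    {K : AffineSubspace ℝ (LinearMap.ker l)} (hK : IsHyperplaneOf K ⊤) :
    (μ.restrict {p | 0 < l (p -ᵥ x)}).map (centralProj l e he x) (K : Set _) = 0 := by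
  obtain ⟨⟨q, hq⟩, -, hrank⟩ := hK
  have hlt : K.direction < ⊤ := by
    refine lt_top_iff_ne_top.2 fun h => ?_
    rw [h, AffineSubspace.direction_top] at hrank
    omega
  obtain ⟨k, hk0, hk⟩ := Submodule.exists_le_ker_of_lt_top _ hlt
  have hsub : (K : Set (LinearMap.ker l)) ⊆ {y | k (y - q) = 0} := fun y hy =>
    hk (AffineSubspace.vsub_mem_direction hy hq)
  refine measure_mono_null hsub ?_
  have hclosed : IsClosed {y : LinearMap.ker l | k (y - q) = 0} :=
    isClosed_eq (k.continuous_of_finiteDimensional.comp (continuous_id.sub continuous_const))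
      continuous_const
  rw [Measure.map_apply_of_aemeasurable (aemeasurable_centralProj μ he x) hclosed.measurableSet]
  have hmeas : MeasurableSet {p : E | 0 < l (p -ᵥ x)} :=
    (isOpen_lt continuous_const (l.continuous_of_finiteDimensional.comp
      (continuous_id.vsub continuous_const))).measurableSet
  rw [Measure.restrict_apply' hmeas]
  let g : V →ₗ[ℝ] ℝ := k ∘ₗ kerProj l e he - k q • l
  have hg : g ≠ 0 := by
    intro h
    refine hk0 (LinearMap.ext fun y => ?_)
    have h1 := LinearMap.congr_fun h (y : V)
    have hy : l y = 0 := y.2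
    have h2 : kerProj l e he y = y := Subtype.ext (by rw [coe_kerProj, hy, zero_smul, sub_zero])
    simpa [g, hy, h2] using h1
  have hae := ae_ne_zero_of_linear_ne_zero hμ
    (g := g.toAffineMap.comp (AffineEquiv.vaddConst ℝ x).symm.toAffineMap) (by
      intro h
      refine hg (LinearMap.ext fun u => ?_)
      simpa using LinearMap.congr_fun h u)
  rw [ae_iff] at hae
  refine measure_mono_null ?_ hae
  rintro p ⟨hp, hp0⟩
  have hp0' : 0 < l (p -ᵥ x) := hp0
  have h1 : k (centralProj l e he x p - q) = 0 := hp
  rw [centralProj, map_sub, map_smul, smul_eq_mul, sub_eq_zero,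
    inv_mul_eq_iff_eq_mul₀ hp0'.ne'] at h1
  change ¬ (g (p -ᵥ x) ≠ 0)
  rw [not_not]
  simp only [g, LinearMap.sub_apply, LinearMap.comp_apply, LinearMap.smul_apply, h1, smul_eq_mul]
  ring

/-- A center of symmetry is a Yao-Yao center. The upper half of the measure is projected centrally
from `x` to a hyperplane `W` not through `x`; the cones with apex `x` over the members of a
Yao-Yao equipartition of the image, together with their reflections, are a Yao-Yao
equipartition. -/
theorem isYaoYaoCenter_of_isCenterOfSymmetry (μ : Measure E) [IsFiniteMeasure μ]
    (hμ : ∀ F : AffineSubspace ℝ E, IsHyperplaneOf F ⊤ → μ (F : Set E) = 0) {x : E}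
    (hx : IsCenterOfSymmetry (V := V) μ x) : IsYaoYaoCenter (V := V) μ x := by
  rcases Nat.eq_zero_or_pos (Module.finrank ℝ V) with hn | hn
  · have hsub : Subsingleton V := Module.finrank_zero_iff.1 hn
    have huniv : (Set.univ : Set E) = {x} := by
      refine Set.eq_singleton_iff_unique_mem.2 ⟨trivial, fun p _ => ?_⟩
      rw [← vsub_eq_zero_iff_eq (G := V)]
      exact Subsingleton.elim _ _
    refine ⟨({{x}} : Set (Set E)), ?_, ?_⟩
    · exact .point _ x (by rw [AffineSubspace.top_coe, huniv])
    rintro _ rfl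
    rw [hn, huniv]
    simp
  let b := Module.finBasis ℝ V
  obtain ⟨l, e, he⟩ : ∃ (l : V →ₗ[ℝ] ℝ) (e : V), l e = 1 :=
    ⟨b.coord ⟨0, hn⟩, b ⟨0, hn⟩, by simp⟩
  have hl0 : l ≠ 0 := by
    rintro rfl
    simp at he
  have hrank : Module.finrank ℝ (LinearMap.ker l) + 1 = Module.finrank ℝ V := by
    have h1 := l.finrank_range_add_finrank_ker
    rw [LinearMap.range_eq_top.2 (LinearMap.surjective hl0), finrank_top,
      Module.finrank_self] at h1
    omega
  let : MeasurableSpace (LinearMap.ker l) := borel _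
  have : BorelSpace (LinearMap.ker l) := ⟨rfl⟩
  set U : Set E := {p | 0 < l (p -ᵥ x)}
  have hUm : MeasurableSet U :=
    (isOpen_lt continuous_const (l.continuous_of_finiteDimensional.comp
      (continuous_id.vsub continuous_const))).measurableSet
  obtain ⟨P, w, ⟨hP, hPν⟩, -, -, hcone⟩ := exists_yaoYaoEquipartition
    ((μ.restrict U).map (centralProj l e he x))
    (fun K hK => map_centralProj_hyperplane hμ he x hK)
  have hae : ∀ᵐ p ∂μ, l (p -ᵥ x) ≠ 0 :=
    ae_ne_zero_of_linear_ne_zero hμ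
      (g := l.toAffineMap.comp (AffineEquiv.vaddConst ℝ x).symm.toAffineMap) (by
        intro h
        refine hl0 (LinearMap.ext fun u => ?_)
        simpa using LinearMap.congr_fun h u)
  have hrefl : ∀ p : E, AffineEquiv.pointReflection ℝ (V₁ := V) x p -ᵥ x = -(p -ᵥ x) := fun p => by
    rw [AffineEquiv.pointReflection_apply, vadd_vsub, neg_vsub_eq_vsub_rev]
  -- the open half-space carries half of the mass
  have hUhalf : μ U = (2 : ℝ≥0∞)⁻¹ * μ Set.univ := by
    have h1 : μ Uᶜ = μ U := by
      rw [← measure_preimage_pointReflection hx U]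
      refine measure_congr ?_
      filter_upwards [hae] with p hp
      refine propext ?_
      change ¬ (0 < l (p -ᵥ x)) ↔ 0 < l (AffineEquiv.pointReflection ℝ (V₁ := V) x p -ᵥ x)
      rw [hrefl, map_neg, not_lt, hp.le_iff_lt, neg_pos]
    rw [← measure_add_measure_compl hUm, h1, ← two_mul, ← mul_assoc,
      ENNReal.inv_mul_cancel (by simp) (by finiteness), one_mul]
  let fpos : LinearMap.ker l →ᵃ[ℝ] E :=
    { toFun := fun a => ((a - w : LinearMap.ker l) : V) +ᵥ x
      linear := (LinearMap.ker l).subtype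
      map_vadd' := fun a u => by
        simp only [vadd_eq_add, vadd_vadd, Submodule.coe_sub, Submodule.coe_add,
          Submodule.subtype_apply, add_sub_assoc] }
  let fneg : LinearMap.ker l →ᵃ[ℝ] E :=
    (AffineEquiv.pointReflection ℝ (V₁ := V) x).toAffineMap.comp fpos
  have hfpos : ∀ a, fpos a = ((a - w : LinearMap.ker l) : V) +ᵥ x := fun _ => rfl
  have hfneg : ∀ a, fneg a = AffineEquiv.pointReflection ℝ (V₁ := V) x (fpos a) := fun _ => rfl
  have hpinj : Function.Injective fpos := fun a a' h => by
    rw [hfpos, hfpos, vadd_right_cancel_iff, Subtype.coe_inj] at h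
    exact sub_left_injective h
  have hninj : Function.Injective fneg :=
    (AffineEquiv.pointReflection ℝ (V₁ := V) x).injective.comp hpinj
  have hmap : (⊤ : AffineSubspace ℝ (LinearMap.ker l)).map fneg = AffineSubspace.map fpos ⊤ := by
    ext p
    simp only [AffineSubspace.mem_map, AffineSubspace.mem_top, true_and]
    have hswap : ∀ a, fneg a = fpos (w - (a - w)) := fun a => by
      rw [hfneg, AffineEquiv.pointReflection_apply, hfpos, hfpos, vsub_vadd_eq_vsub_sub, vsub_self,
        zero_sub, sub_sub_cancel_left, Submodule.coe_neg]
    constructor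
    · rintro ⟨a, rfl⟩
      exact ⟨_, (hswap a).symm⟩
    · rintro ⟨a, rfl⟩
      refine ⟨w - (a - w), ?_⟩
      rw [hswap]
      congr 1
      abel
  have hxpos : fpos w = x := by rw [hfpos, sub_self, Submodule.coe_zero, zero_vadd]
  have hxneg : fneg w = x := by rw [hfneg, hxpos, AffineEquiv.pointReflection_self]
  have hdir : (AffineSubspace.map fpos ⊤).direction = LinearMap.ker l := by
    rw [AffineSubspace.map_direction, AffineSubspace.direction_top, Submodule.map_top]
    exact Submodule.range_subtype _
  have hw : l w = 0 := w.2
  have hPpos := IsPartitionOf.map hP hpinj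
  have hPneg := IsPartitionOf.map hP hninj
  rw [hxpos] at hPpos
  rw [hxneg, hmap] at hPneg
  have hmass : ∀ A ∈ P, μ (sweep (fpos '' A) (e + (w : V))) =
      ((2 : ℝ≥0∞) ^ Module.finrank ℝ V)⁻¹ * μ Set.univ := by
    intro A hA
    have hTm := aemeasurable_centralProj μ he x
    have h1 : μ (sweep (fpos '' A) (e + (w : V))) = μ (centralProj l e he x ⁻¹' A ∩ U) := by
      refine measure_congr ?_
      filter_upwards [hae] with p hp
      refine propext ?_
      change p ∈ sweep (fpos '' A) (e + (w : V)) ↔ centralProj l e he x p ∈ A ∧ 0 < l (p -ᵥ x)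
      have hiff := fun hpos : 0 < l (p -ᵥ x) => mem_sweep_iff_centralProj_mem (A := A) (w := w) he
        (fun a ha t ht => (hcone A hA).smul_vsub_vadd_mem ha ht) hpos
      constructor
      · intro h
        have hpos : 0 < l (p -ᵥ x) := by
          refine lt_of_le_of_ne ?_ hp.symm
          obtain ⟨_, ⟨a, -, rfl⟩, t, ht, rfl⟩ := h
          have ha : l a = 0 := a.2
          rw [hfpos, vadd_vadd, vadd_vsub]
          simpa [he, hw, ha] using ht
        exact ⟨(hiff hpos).1 h, hpos⟩
      · rintro ⟨h, hpos⟩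
        exact (hiff hpos).2 h
    have h2 := hPν A hA
    rw [Measure.map_apply_of_aemeasurable hTm (hcone A hA).measurableSet,
      Measure.map_apply_of_aemeasurable hTm MeasurableSet.univ, Measure.restrict_apply' hUm,
      Set.preimage_univ, Measure.restrict_apply_univ, hUhalf] at h2
    rw [h1, h2, ← hrank, pow_succ, ENNReal.mul_inv (Or.inr (by finiteness)) (Or.inr (by simp)),
      mul_assoc]
  refine ⟨_, .step ⊤ _ (e + (w : V)) _ _ x ⟨?_, le_top, ?_⟩ ?_ ?_ hPpos hPneg, ?_⟩
  · exact ⟨x, w, trivial, hxpos⟩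
  · rw [hdir, AffineSubspace.direction_top, finrank_top, hrank]
  · rw [AffineSubspace.direction_top]
    trivial
  · rw [hdir, LinearMap.mem_ker, map_add, he, hw, add_zero]
    exact one_ne_zero
  · rintro _ (⟨_, ⟨A, hA, rfl⟩, rfl⟩ | ⟨_, ⟨A, hA, rfl⟩, rfl⟩)
    · have h1 : sweep (fneg '' A) (-(e + (w : V))) =
          AffineEquiv.pointReflection ℝ (V₁ := V) x '' sweep (fpos '' A) (e + (w : V)) := by
        have h2 := image_sweep (AffineEquiv.pointReflection ℝ (V₁ := V) x).toAffineMap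
          (fpos '' A) (e + (w : V))
        rw [Set.image_image] at h2
        have h3 : ∀ u, (AffineEquiv.pointReflection ℝ (V₁ := V) x).toAffineMap.linear u = -u :=
          fun u => rfl
        rw [h3] at h2
        exact h2.symm
      beta_reduce
      rw [h1, ← measure_preimage_pointReflection hx, Set.preimage_image_eq _
        (AffineEquiv.pointReflection ℝ (V₁ := V) x).injective]
      exact hmass A hA
    · exact hmass A hA

end Symmetric

end YaoYao

theorem mainTheorem1 {V E : Type*}
    [AddCommGroup V] [Module ℝ V] [FiniteDimensional ℝ V]
    [TopologicalSpace V] [IsTopologicalAddGroup V] [ContinuousSMul ℝ V] [T2Space V]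
    [AddTorsor V E] [TopologicalSpace E] [IsTopologicalAddTorsor E]
    [MeasurableSpace E] [BorelSpace E]
    (μ : MeasureTheory.Measure E) [MeasureTheory.IsFiniteMeasure μ]
    (hμ : ∀ F : AffineSubspace ℝ E, YaoYao.IsHyperplaneOf F ⊤ → μ (F : Set E) = 0) :
    (∃ (P : Set (Set E)) (x : E), YaoYao.IsYaoYaoEquipartition (V := V) μ P x ∧
      P.ncard = 2 ^ Module.finrank ℝ V ∧ YaoYao.IsPartition P ∧
      ∀ A ∈ P, YaoYao.IsSimplicialCone (V := V) x A) ∧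
    ∀ x : E, YaoYao.IsCenterOfSymmetry (V := V) μ x →
      YaoYao.IsYaoYaoCenter (V := V) μ x := by
  exact ⟨YaoYao.exists_yaoYaoEquipartition μ hμ,
    fun _ hx => YaoYao.isYaoYaoCenter_of_isCenterOfSymmetry μ hμ hx⟩
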